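/- All vector spaces are real and finite-dimensional. An $\mathcal{LA}$-Courant algebroid over a point consists of a double vector bundle $$\begin{array}{ccc}\mathbb{A}&\to& V\\ \downarrow&&\downarrow\\ \ast&\to&\ast\end{array}$$ together with the structure of a Courant algebroid on $\mathbb{A}\to\ast$ (a bracket and a non-degenerate symmetric pairing) and of a Lie algebroid on $\mathbb{A}\to V$, such that: (a) the graph of the addition of $\mathbb{A}\to V$ is a Courant relation $\mathbb{A}\times\mathbb{A}\dashrightarrow\mathbb{A}$; (b) the graph of the addition of the vector space $\mathbb{A}$ is a Lie subalgebroid of $(\mathbb{A}\to V)^3$; (c) if $\pi^\sharp:T^*(\mathbb{A}^*_V)\to T(\mathbb{A}^*_V)$ is the anchor of the linear Poisson structure on the dual $\mathbb{A}^*_V$ of $\mathbb{A}\to V$, then the relation $\Pi_{\mathbb{A}}:T\mathbb{A}\dashrightarrow T\mathbb{A}$ which is the annihilator of the graph of $\pi^\sharp$ (dualizing $T^*(\mathbb{A}^*_V)\cong T^*\mathbb{A}$ over $\mathbb{A}$ and $T(\mathbb{A}^*_V)$ over $TV$) is a Courant relation for the tangent prolongation of $\mathbb{A}$. An $\mathcal{LA}$-Dirac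 structure is a double vector subbundle $L\subseteq\mathbb{A}$ which is a Dirac structure of $\mathbb{A}\to\ast$ and a Lie subalgebroid of $\mathbb{A}\to V$. For a Lie algebra $\mathfrak{g}$ and an invariant symmetric bilinear form $\beta\in S^2(\mathfrak{g})^{\mathfrak{g}}$ on $\mathfrak{g}^*$, let $\beta^\sharp:\mathfrak{g}^*\to\mathfrak{g}$, $\beta^\sharp(\mu)=\beta(\mu,\cdot)$, and let $\mathbb{A}_{\mathfrak{g},\beta}=\mathfrak{g}\ltimes\mathfrak{g}^*$ with side bundle $V=\mathfrak{g}$, the semidirect product bracket for the coadjoint action, the natural pairing, and the Lie algebroid structure over $\mathfrak{g}$ of the action Lie algebroid of the abelian Lie algebra $\mathfrak{g}^*$ acting on $\mathfrak{g}$ by the constant vector fields $\beta^\sharp(\mu)$. **Proposition.** (1) Each $\mathbb{A}_{\mathfrak{g},\beta}$ is an $\mathcal{LA}$-Courant algebroid over a point, and every $\mathcal{LA}$-Courant algebroid over a point is isomorphic to some $\mathbb{A}_{\mathfrak{g},\beta}$. The isomorphisms $\mathbb{A}_{\mathfrak{g},\beta}\to\mathbb{A}_{\mathfrak{g}',\beta'}$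 are exactly the maps $(x,\mu)\mapsto(\varphi(x),\mu\circ\varphi^{-1})$, covering $\varphi$, for the Lie algebra isomorphisms $\varphi:\mathfrak{g}\to\mathfrak{g}'$ carrying $\beta$ to $\beta'$. Thus $\mathcal{LA}$-Courant algebroids over a point are in one-to-one correspondence with pairs $(\mathfrak{g},\beta)$, up to isomorphism. (2) A subset $L\subseteq\mathbb{A}_{\mathfrak{g},\beta}$ is an $\mathcal{LA}$-Dirac structure if and only if $L=\mathfrak{h}\ltimes\operatorname{ann}(\mathfrak{h})$ for a (necessarily unique) Lie subalgebra $\mathfrak{h}\subseteq\mathfrak{g}$ which is $\beta$-coisotropic, i.e. $\beta^\sharp(\operatorname{ann}(\mathfrak{h}))\subseteq\mathfrak{h}$. -/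

import Mathlib

universe u v w

open scoped ContDiff

noncomputable section

namespace LACourant

/-! ### Calculus on finite-dimensional real vector spaces

Every finite-dimensional real vector space carries its canonical smooth structure: the
one for which linear coordinates are smooth. -/

section Calculus

/-- Linear coordinates on a finite-dimensional real vector space. -/
def coords (E : Type*) [AddCommGroup E] [Module ℝ E] [FiniteDimensional ℝ E] :
    E ≃ₗ[ℝ] (Fin (Module.finrank ℝ E) → ℝ) :=
  (Module.finBasis ℝ E).equivFun

variable {E F : Type*} [AddCommGroup E] [Module ℝ E] [FiniteDimensional ℝ E]
  [AddCommGroup F] [Module ℝ F] [FiniteDimensional ℝ F]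

/-- Open subsets for the canonical topology of a finite-dimensional real vector space. -/
def IsOpenSet (U : Set E) : Prop := IsOpen ((coords E).symm ⁻¹' U)

/-- Smoothness of a map on a subset of a finite-dimensional real vector space. -/
def SmoothOn (f : E → F) (s : Set E) : Prop :=
  ContDiffOn ℝ ∞ (fun x => coords F (f ((coords E).symm x))) ((coords E).symm ⁻¹' s)

/-- Smooth maps between finite-dimensional real vector spaces. -/
def Smooth (f : E → F) : Prop :=
  ContDiff ℝ ∞ (fun x => coords F (f ((coords E).symm x)))

/-- The derivative of `f` at `x` in the direction `h`. -/
def dirDeriv (f : E → F) (x h : E) : F :=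
  (coords F).symm (lineDeriv ℝ (fun y => coords F (f y)) x h)

/-- The vectors tangent at `p` to the subset (submanifold) `N`: velocities of smooth curves
that stay in `N`. -/
def tangentVectors (N : Set E) (p : E) : Set E :=
  {h | ∃ γ : ℝ → E, Smooth γ ∧ (∀ t, γ t ∈ N) ∧ γ 0 = p ∧ dirDeriv γ 0 1 = h}

/-- `N` is coisotropic in the manifold `E` for the bivector field `π`: at every point of `N`,
`π` vanishes on pairs of covectors which annihilate the tangent space of `N`. Here `Cov` is
a model of the space of covectors, with evaluation `ev`. -/
def IsCoisotropic {Cov : Type*} (ev : Cov → E → ℝ) (π : E → Cov → Cov → ℝ) (N : Set E) :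
    Prop :=
  ∀ p ∈ N, ∀ α α' : Cov,
    (∀ h ∈ tangentVectors N p, ev α h = 0) → (∀ h ∈ tangentVectors N p, ev α' h = 0) →
      π p α α' = 0

lemma smooth_of_linear (f : E →ₗ[ℝ] F) : Smooth f :=
  (LinearMap.toContinuousLinearMap
    ((coords F).toLinearMap ∘ₗ f ∘ₗ (coords E).symm.toLinearMap)).contDiff

end Calculus

/-! ### Courant algebroids over a point -/

/-- A bilinear form and a bilinear bracket on a vector space. -/
structure MetricBracket (E : Type*) [AddCommGroup E] [Module ℝ E] where
  metric : LinearMap.BilinForm ℝ E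
  bracket : E →ₗ[ℝ] E →ₗ[ℝ] E

namespace MetricBracket

variable {E F : Type*} [AddCommGroup E] [Module ℝ E] [AddCommGroup F] [Module ℝ F]

/-- The axioms of a Courant algebroid over a point (the anchor takes values in the zero
vector space). -/
structure IsCourantAlgebroid (Q : MetricBracket E) : Prop where
  metric_symm : ∀ x y, Q.metric x y = Q.metric y x
  metric_nondegenerate : ∀ x, (∀ y, Q.metric x y = 0) → x = 0
  jacobi : ∀ x y z, Q.bracket x (Q.bracket y z) =
    Q.bracket (Q.bracket x y) z + Q.bracket y (Q.bracket x z)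
  metric_invariant : ∀ x y z, 0 = Q.metric (Q.bracket x y) z + Q.metric y (Q.bracket x z)
  bracket_add_swap : ∀ x y, Q.bracket x y + Q.bracket y x = 0

/-- The same bracket, with the metric negated. -/
def bar (Q : MetricBracket E) : MetricBracket E := ⟨-Q.metric, Q.bracket⟩

/-- The direct product. -/
def prod (Q : MetricBracket E) (R : MetricBracket F) : MetricBracket (E × F) where
  metric := LinearMap.mk₂ ℝ (fun x y => Q.metric x.1 y.1 + R.metric x.2 y.2)
    (by intros; simp; ring) (by intros; simp; ring) (by intros; simp; ring)
    (by intros; simp; ring)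
  bracket := LinearMap.mk₂ ℝ (fun x y => (Q.bracket x.1 y.1, R.bracket x.2 y.2))
    (by intros; ext <;> simp) (by intros; ext <;> simp) (by intros; ext <;> simp)
    (by intros; ext <;> simp)

/-- The tangent prolongation, on `TE = E × E` (pairs of a base point and a velocity): `(x, 0)`
is the tangent lift of `x` and `(0, x)` is its core lift. -/
def tangent (Q : MetricBracket E) : MetricBracket (E × E) where
  metric := LinearMap.mk₂ ℝ (fun x y => Q.metric x.1 y.2 + Q.metric x.2 y.1)
    (by intros; simp; ring) (by intros; simp; ring) (by intros; simp; ring)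
    (by intros; simp; ring)
  bracket := LinearMap.mk₂ ℝ
    (fun x y => (Q.bracket x.1 y.1, Q.bracket x.1 y.2 + Q.bracket x.2 y.1))
    (by intros; ext <;> simp; abel) (by intros; ext <;> simp)
    (by intros; ext <;> simp; abel) (by intros; ext <;> simp)

/-- Dirac structures: `L` equals its orthogonal complement (so that it is a linear subspace) and
is closed under the bracket. -/
structure IsDirac (Q : MetricBracket E) (L : Set E) : Prop where
  lagrangian : ∀ x, x ∈ L ↔ ∀ y ∈ L, Q.metric x y = 0
  involutive : ∀ x ∈ L, ∀ y ∈ L, Q.bracket x y ∈ L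

/-- Courant relations from `Q` to `R`; the elements of `rel` are pairs (target, source). -/
def IsCourantRelation (Q : MetricBracket E) (R : MetricBracket F) (rel : Set (F × E)) :
    Prop :=
  (R.prod Q.bar).IsDirac rel

end MetricBracket

/-! ### Double vector bundles over a point -/

/-- A double vector bundle with sides `V` and `A = M = pt`: the total space `𝔸` is a vector
space (a vector bundle over `A`) and, by means of a linear map `proj`, a smooth vector bundle
over `V`, and the two structures satisfy the interchange laws. -/
structure DoubleVB (V : Type*) (𝔸 : Type*)
    [AddCommGroup V] [Module ℝ V] [FiniteDimensional ℝ V]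
    [AddCommGroup 𝔸] [Module ℝ 𝔸] [FiniteDimensional ℝ 𝔸] where
  proj : 𝔸 →ₗ[ℝ] V
  fibreAddCommGroup : ∀ v, AddCommGroup {d : 𝔸 // proj d = v}
  fibreModule : ∀ v, Module ℝ {d : 𝔸 // proj d = v}
  locally_trivial : ∀ v₀ : V, ∃ (U : Set V) (n : ℕ)
    (φ : ∀ v, {d : 𝔸 // proj d = v} ≃ₗ[ℝ] (Fin n → ℝ)),
    IsOpenSet U ∧ v₀ ∈ U ∧
    SmoothOn (fun d : 𝔸 => φ (proj d) ⟨d, rfl⟩) (proj ⁻¹' U) ∧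
    SmoothOn (fun p : V × (Fin n → ℝ) => ((φ p.1).symm p.2 : 𝔸)) (U ×ˢ Set.univ)
  add_interchange : ∀ (v v' : V) (x y : {d : 𝔸 // proj d = v}) (x' y' : {d : 𝔸 // proj d = v'}),
    ((x + y : {d : 𝔸 // proj d = v}) : 𝔸) + (x' + y' : {d : 𝔸 // proj d = v'}) =
      ((⟨x + x', by rw [map_add, x.2, x'.2]⟩ + ⟨y + y', by rw [map_add, y.2, y'.2]⟩ :
        {d : 𝔸 // proj d = v + v'}) : 𝔸)
  smul_interchange : ∀ (t : ℝ) (v : V) (x y : {d : 𝔸 // proj d = v}),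
    t • ((x + y : {d : 𝔸 // proj d = v}) : 𝔸) =
      ((⟨t • (x : 𝔸), by rw [map_smul, x.2]⟩ + ⟨t • (y : 𝔸), by rw [map_smul, y.2]⟩ :
        {d : 𝔸 // proj d = t • v}) : 𝔸)
  fibre_smul_interchange : ∀ (t : ℝ) (v v' : V) (x : {d : 𝔸 // proj d = v})
    (x' : {d : 𝔸 // proj d = v'}),
    ((t • ⟨x + x', by rw [map_add, x.2, x'.2]⟩ : {d : 𝔸 // proj d = v + v'}) : 𝔸) =
      (t • x : {d : 𝔸 // proj d = v}) + (t • x' : {d : 𝔸 // proj d = v'})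

namespace DoubleVB

variable {V : Type*} {𝔸 : Type*} [AddCommGroup V] [Module ℝ V] [FiniteDimensional ℝ V]
  [AddCommGroup 𝔸] [Module ℝ 𝔸] [FiniteDimensional ℝ 𝔸]

/-- The fibre of `𝔸 → V` over `v`. -/
abbrev Fibre (D : DoubleVB V 𝔸) (v : V) : Type _ := {d : 𝔸 // D.proj d = v}

instance (D : DoubleVB V 𝔸) (v : V) : AddCommGroup (D.Fibre v) := D.fibreAddCommGroup v

instance (D : DoubleVB V 𝔸) (v : V) : Module ℝ (D.Fibre v) := D.fibreModule v

/-- Smooth sections of `𝔸 → V`. -/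
def IsSmoothSection (D : DoubleVB V 𝔸) (σ : ∀ v, D.Fibre v) : Prop :=
  Smooth (fun v => (σ v : 𝔸))

/-- The core. -/
abbrev Core (D : DoubleVB V 𝔸) : Submodule ℝ 𝔸 := LinearMap.ker D.proj

/-- The core component of `d`, namely the difference in the vector space `𝔸` of `d` and the
zero element of the fibre through `d`. This identifies each fibre of `𝔸 → V` with the core. -/
def corePart (D : DoubleVB V 𝔸) (d : 𝔸) : D.Core :=
  ⟨d - ((0 : D.Fibre (D.proj d)) : 𝔸), by
    rw [LinearMap.mem_ker, map_sub, (0 : D.Fibre (D.proj d)).2, sub_self]⟩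

/-- The section of `𝔸 → V` defined by an element of the core, `v ↦ 0_v + c`. -/
def coreSection (D : DoubleVB V 𝔸) (c : D.Core) (v : V) : D.Fibre v :=
  ⟨((0 : D.Fibre v) : 𝔸) + c, by
    rw [map_add, (0 : D.Fibre v).2, LinearMap.mem_ker.mp c.2, add_zero]⟩

/-- The graph of the addition of `𝔸 → V`, as a relation from `𝔸 × 𝔸` to `𝔸`. -/
def graphFibreAdd (D : DoubleVB V 𝔸) : Set (𝔸 × (𝔸 × 𝔸)) :=
  {z | ∃ (v : V) (x y : D.Fibre v), z = (((x + y : D.Fibre v) : 𝔸), ((x : 𝔸), (y : 𝔸)))}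

/-- Double vector subbundles: subsets closed under both vector bundle structures.
(Such a subset is a vector subspace `L` of `𝔸`, and is the sum of the zero section over
`W = proj L` and of a subspace of the core, hence a smooth subbundle over `W`.) -/
structure IsSubbundle (D : DoubleVB V 𝔸) (L : Set 𝔸) : Prop where
  zero_mem : (0 : 𝔸) ∈ L
  add_mem : ∀ x ∈ L, ∀ y ∈ L, x + y ∈ L
  smul_mem : ∀ (t : ℝ), ∀ x ∈ L, t • x ∈ L
  fibre_add_mem : ∀ (v : V) (x y : D.Fibre v), (x : 𝔸) ∈ L → (y : 𝔸) ∈ L →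
    ((x + y : D.Fibre v) : 𝔸) ∈ L
  fibre_smul_mem : ∀ (t : ℝ) (v : V) (x : D.Fibre v), (x : 𝔸) ∈ L →
    ((t • x : D.Fibre v) : 𝔸) ∈ L

/-- The total space of the dual of `𝔸 → V`: the fibre over `v` is the dual of the core, by the
identification of the fibres of `𝔸 → V` with the core. Its tangent space at every point is the
same vector space. -/
abbrev DualBundle (D : DoubleVB V 𝔸) : Type _ := V × Module.Dual ℝ D.Core

/-- The covectors on the total space of the dual of `𝔸 → V`, at any point. -/
abbrev DualCovector (D : DoubleVB V 𝔸) : Type _ := Module.Dual ℝ V × D.Core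

/-- The evaluation of covectors on tangent vectors of the dual of `𝔸 → V`. -/
def covEval (D : DoubleVB V 𝔸) (p : D.DualCovector) (h : D.DualBundle) : ℝ :=
  p.1 h.1 + h.2 p.2

/-- The annihilator, in the dual of `𝔸 → V`, of a subbundle `L → proj L`. -/
def annihilator (D : DoubleVB V 𝔸) (L : Set 𝔸) : Set D.DualBundle :=
  {p | p.1 ∈ D.proj '' L ∧ ∀ d ∈ L, D.proj d = p.1 → p.2 (D.corePart d) = 0}

/-- The annihilator, in the third power of the dual of `𝔸 → V`, of the graph
`{(d + d'; d, d')}` of the addition of the vector space `𝔸`. -/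
def annihilatorGraphAdd (D : DoubleVB V 𝔸) :
    Set (D.DualBundle × D.DualBundle × D.DualBundle) :=
  {p | p.1.1 = p.2.1.1 + p.2.2.1 ∧ ∀ d d' : 𝔸, D.proj d = p.2.1.1 → D.proj d' = p.2.2.1 →
    p.1.2 (D.corePart (d + d')) + p.2.1.2 (D.corePart d) + p.2.2.2 (D.corePart d') = 0}

/-- The pairing of `T𝔸 → TV` with the tangent bundle of the dual of `𝔸 → V`: the derivative
of the pairing of `𝔸` with its dual. The tangent vectors are `(b, b')` and `(q, h)`, with equal
images in `TV`. -/
def tangentPairing (D : DoubleVB V 𝔸) (Y : 𝔸 × 𝔸) (Z : D.DualBundle × D.DualBundle) : ℝ :=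
  Z.1.2 (D.corePart Y.2) + Z.2.2 (D.corePart Y.1)

/-- The pairing of `T𝔸 → 𝔸` with the cotangent bundle of the dual of `𝔸 → V`, the latter being
a bundle over `𝔸` by `(q, p) ↦ 0_v + p.2` for `q` over `v`: the pairing of `X` with
`(q, p)` is `⟨X, Z⟩ - p(Z)` for any tangent vector `Z` at `q` with the same image in `TV`
as `X` (here `Z = (q, (proj X.2, 0))`), `⟨X, Z⟩` being the pairing above. -/
def cotangentPairing (D : DoubleVB V 𝔸) (X : 𝔸 × 𝔸) (P : D.DualBundle × D.DualCovector) : ℝ :=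
  D.tangentPairing X (P.1, (D.proj X.2, 0)) - D.covEval P.2 (D.proj X.2, 0)

end DoubleVB

/-! ### LA-Courant algebroids over a point -/

/-- The data of an LA-Courant algebroid over a point: a double vector bundle, a metric and a
bracket on the vector space `𝔸`, and an anchor and a bracket of sections for `𝔸 → V`. (Only the
brackets of smooth sections matter.) -/
structure Data (V : Type*) (𝔸 : Type*)
    [AddCommGroup V] [Module ℝ V] [FiniteDimensional ℝ V]
    [AddCommGroup 𝔸] [Module ℝ 𝔸] [FiniteDimensional ℝ 𝔸] extends DoubleVB V 𝔸 where
  courant : MetricBracket 𝔸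
  anchor : 𝔸 → V
  bracket : (∀ v, toDoubleVB.Fibre v) → (∀ v, toDoubleVB.Fibre v) → ∀ v, toDoubleVB.Fibre v

namespace Data

variable {V : Type*} {𝔸 : Type*} [AddCommGroup V] [Module ℝ V] [FiniteDimensional ℝ V]
  [AddCommGroup 𝔸] [Module ℝ 𝔸] [FiniteDimensional ℝ 𝔸]

/-- `𝔸` is a Courant algebroid over a point, for which the addition of `𝔸 → V` is a Courant
relation from `𝔸 × 𝔸` to `𝔸`. -/
structure IsVBCourant (A : Data V 𝔸) : Prop where
  courantAlgebroid : A.courant.IsCourantAlgebroid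
  graph_add : (A.courant.prod A.courant).IsCourantRelation A.courant A.graphFibreAdd

/-- `𝔸 → V` is a Lie algebroid. -/
structure IsLieAlgebroid (A : Data V 𝔸) : Prop where
  anchor_smooth : Smooth A.anchor
  anchor_add : ∀ (v : V) (x y : A.Fibre v),
    A.anchor (x + y : A.Fibre v) = A.anchor x + A.anchor y
  anchor_smul : ∀ (t : ℝ) (v : V) (x : A.Fibre v), A.anchor (t • x : A.Fibre v) = t • A.anchor x
  bracket_smooth : ∀ σ τ, A.IsSmoothSection σ → A.IsSmoothSection τ →
    A.IsSmoothSection (A.bracket σ τ)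
  bracket_add : ∀ σ τ υ, A.IsSmoothSection σ → A.IsSmoothSection τ → A.IsSmoothSection υ →
    A.bracket σ (τ + υ) = A.bracket σ τ + A.bracket σ υ
  bracket_smul : ∀ (t : ℝ) (σ τ), A.IsSmoothSection σ → A.IsSmoothSection τ →
    A.bracket σ (t • τ) = t • A.bracket σ τ
  bracket_skew : ∀ σ τ, A.IsSmoothSection σ → A.IsSmoothSection τ →
    A.bracket σ τ = -A.bracket τ σ
  jacobi : ∀ σ τ υ, A.IsSmoothSection σ → A.IsSmoothSection τ → A.IsSmoothSection υ →
    A.bracket σ (A.bracket τ υ) = A.bracket (A.bracket σ τ) υ + A.bracket τ (A.bracket σ υ)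
  leibniz : ∀ σ τ (f : V → ℝ), A.IsSmoothSection σ → A.IsSmoothSection τ → Smooth f →
    A.bracket σ (fun v => f v • τ v) =
      fun v => lineDeriv ℝ f v (A.anchor (σ v)) • τ v + f v • A.bracket σ τ v

/-- The bivector field of the linear Poisson structure on the dual of `𝔸 → V`. It is determined by
`{⟨σ, ·⟩, ⟨τ, ·⟩} = ⟨[σ, τ], ·⟩`, `{⟨σ, ·⟩, f} = anchor(σ) f` and `{f, g} = 0` for sections `σ`,
`τ` of `𝔸 → V` and functions `f`, `g` on `V`, where `(α, c)` is the differential at `q` of the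
sum of the linear function of the core section `c` and of the linear function `α` on `V`. -/
def poisson (A : Data V 𝔸) (q : A.DualBundle) (p p' : A.DualCovector) : ℝ :=
  q.2 (A.corePart (A.bracket (A.coreSection p.2) (A.coreSection p'.2) q.1))
    + p'.1 (A.anchor (A.coreSection p.2 q.1)) - p.1 (A.anchor (A.coreSection p'.2 q.1))

/-- A subbundle is a Lie subalgebroid when its annihilator is coisotropic for the linear Poisson
structure on the dual. -/
def IsLieSubalgebroid (A : Data V 𝔸) (L : Set 𝔸) : Prop :=
  IsCoisotropic A.covEval A.poisson (A.annihilator L)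

/-- `𝔸 → V` is a Lie algebroid, and the graph of the addition of the vector space `𝔸` is a Lie
subalgebroid of the third power of `𝔸 → V`. -/
structure IsLAVectorBundle (A : Data V 𝔸) : Prop where
  lieAlgebroid : A.IsLieAlgebroid
  graph_add : IsCoisotropic
    (fun (p : A.DualCovector × A.DualCovector × A.DualCovector) h =>
      A.covEval p.1 h.1 + A.covEval p.2.1 h.2.1 + A.covEval p.2.2 h.2.2)
    (fun q p p' => A.poisson q.1 p.1 p'.1 + A.poisson q.2.1 p.2.1 p'.2.1
      + A.poisson q.2.2 p.2.2 p'.2.2)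
    A.annihilatorGraphAdd

/-- The graph of the anchor map from the cotangent to the tangent bundle of the dual of `𝔸 → V`
given by contraction with the Poisson bivector field, with elements (target, source). -/
def graphSharp (A : Data V 𝔸) :
    Set ((A.DualBundle × A.DualBundle) × (A.DualBundle × A.DualCovector)) :=
  {z | z.1.1 = z.2.1 ∧ ∀ p' : A.DualCovector, A.covEval p' z.1.2 = A.poisson z.2.1 z.2.2 p'}

/-- For `Y`, `X` in `T𝔸` and `z` in the graph above: the two components of `z` lie in the fibres
dual to those of `Y` (over `TV`) and of `X` (over `𝔸`). -/
def Composable (A : Data V 𝔸) (Y X : 𝔸 × 𝔸)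
    (z : (A.DualBundle × A.DualBundle) × (A.DualBundle × A.DualCovector)) : Prop :=
  (z.1.1.1 = A.proj Y.1 ∧ z.1.2.1 = A.proj Y.2) ∧ (A.coreSection z.2.2.2 z.2.1.1 : 𝔸) = X.1

/-- The relation from `T𝔸` (as a bundle over `𝔸`) to `T𝔸` (as a bundle over `TV`) which is the
annihilator of the graph of the Poisson anchor map, consisting of the pairs `(Y, X)` over the
base of that graph with equal pairings on all its elements. -/
def poissonRelation (A : Data V 𝔸) : Set ((𝔸 × 𝔸) × (𝔸 × 𝔸)) :=
  {w | (∃ z ∈ A.graphSharp, A.Composable w.1 w.2 z) ∧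
    ∀ z ∈ A.graphSharp, A.Composable w.1 w.2 z →
      A.tangentPairing w.1 z.1 = A.cotangentPairing w.2 z.2}

/-- LA-Courant algebroids over a point. -/
structure IsLACourant (A : Data V 𝔸) : Prop where
  vbCourant : A.IsVBCourant
  laVectorBundle : A.IsLAVectorBundle
  courantRelation :
    A.courant.tangent.IsCourantRelation A.courant.tangent A.poissonRelation

/-- LA-Dirac structures: double vector subbundles which are Dirac structures for the Courant
algebroid `𝔸 → pt` and Lie subalgebroids of `𝔸 → V`. -/
structure IsLADirac (A : Data V 𝔸) (L : Set 𝔸) : Prop where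
  subbundle : A.IsSubbundle L
  dirac : A.courant.IsDirac L
  lieSubalgebroid : A.IsLieSubalgebroid L

/-- The pair of `Φ` and `φ` is an isomorphism of LA-Courant algebroids over a point. -/
structure IsIso {V' : Type*} {𝔸' : Type*}
    [AddCommGroup V'] [Module ℝ V'] [FiniteDimensional ℝ V']
    [AddCommGroup 𝔸'] [Module ℝ 𝔸'] [FiniteDimensional ℝ 𝔸']
    (A : Data V 𝔸) (A' : Data V' 𝔸') (Φ : 𝔸 ≃ₗ[ℝ] 𝔸') (φ : V ≃ₗ[ℝ] V') : Prop where
  map_proj : ∀ d, A'.proj (Φ d) = φ (A.proj d)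
  map_fibre_add : ∀ (v : V) (x y : A.Fibre v) (x' y' : A'.Fibre (φ v)),
    Φ x = x' → Φ y = y' → Φ (x + y : A.Fibre v) = (x' + y' : A'.Fibre (φ v))
  map_fibre_smul : ∀ (t : ℝ) (v : V) (x : A.Fibre v) (x' : A'.Fibre (φ v)),
    Φ x = x' → Φ (t • x : A.Fibre v) = (t • x' : A'.Fibre (φ v))
  map_metric : ∀ d e, A'.courant.metric (Φ d) (Φ e) = A.courant.metric d e
  map_courant : ∀ d e, A'.courant.bracket (Φ d) (Φ e) = Φ (A.courant.bracket d e)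
  map_anchor : ∀ d, A'.anchor (Φ d) = φ (A.anchor d)
  map_bracket : ∀ (σ τ : ∀ v, A.Fibre v) (σ' τ' : ∀ v', A'.Fibre v'),
    A.IsSmoothSection σ → A.IsSmoothSection τ →
    A'.IsSmoothSection σ' → A'.IsSmoothSection τ' →
    (∀ v, Φ (σ v) = σ' (φ v)) → (∀ v, Φ (τ v) = τ' (φ v)) →
    ∀ v, Φ (A.bracket σ τ v) = A'.bracket σ' τ' (φ v)

end Data

/-! ### The LA-Courant algebroid of a Lie algebra with an invariant symmetric form -/

section Model

/-- The fibres of the projection `V × C → V` are copies of `C`. -/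
def directSumFibre (V C : Type*) [AddCommGroup V] [Module ℝ V] [AddCommGroup C] [Module ℝ C]
    (v : V) : {d : V × C // LinearMap.fst ℝ V C d = v} ≃ C where
  toFun d := d.1.2
  invFun c := ⟨(v, c), rfl⟩
  left_inv d := by
    obtain ⟨⟨a, c⟩, rfl⟩ := d
    rfl
  right_inv _ := rfl

/-- The double vector bundle `V × C → V` over a point, with core `C`. -/
def DoubleVB.directSum (V C : Type*)
    [AddCommGroup V] [Module ℝ V] [FiniteDimensional ℝ V]
    [AddCommGroup C] [Module ℝ C] [FiniteDimensional ℝ C] : DoubleVB V (V × C) where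
  proj := LinearMap.fst ℝ V C
  fibreAddCommGroup v := (directSumFibre V C v).addCommGroup
  fibreModule v := (directSumFibre V C v).module ℝ
  locally_trivial v₀ := by
    let := fun v => (directSumFibre V C v).addCommGroup
    let := fun v => (directSumFibre V C v).module ℝ
    refine ⟨Set.univ, Module.finrank ℝ C,
      fun v => ((directSumFibre V C v).linearEquiv ℝ).trans (coords C), ?_, trivial, ?_, ?_⟩
    · simp [IsOpenSet]
    · exact ContDiff.contDiffOn
        (smooth_of_linear ((coords C).toLinearMap ∘ₗ LinearMap.snd ℝ V C))
    · exact ContDiff.contDiffOn (smooth_of_linear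
        ((LinearMap.id : V →ₗ[ℝ] V).prodMap (coords C).symm.toLinearMap))
  add_interchange v v' x y x' y' := by
    obtain ⟨⟨a, c⟩, rfl⟩ := x
    obtain ⟨⟨a', c'⟩, rfl⟩ := x'
    obtain ⟨⟨b, d⟩, hb⟩ := y
    obtain ⟨⟨b', d'⟩, hb'⟩ := y'
    exact Prod.ext rfl (add_add_add_comm c d c' d')
  smul_interchange t v x y := Prod.ext rfl (smul_add t x.1.2 y.1.2)
  fibre_smul_interchange t v v' x x' := Prod.ext rfl (smul_add t x.1.2 x'.1.2)

variable (𝔤 : Type*) [LieRing 𝔤] [LieAlgebra ℝ 𝔤] [FiniteDimensional ℝ 𝔤]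

/-- The semidirect product of `𝔤` with the coadjoint representation, with the bilinear form given
by the natural pairing. -/
def semidirect : MetricBracket (𝔤 × Module.Dual ℝ 𝔤) where
  metric := LinearMap.mk₂ ℝ (fun d e => d.2 e.1 + e.2 d.1)
    (by intros; simp; ring) (by intros; simp; ring) (by intros; simp; ring)
    (by intros; simp; ring)
  bracket := LinearMap.mk₂ ℝ (fun d e => (⁅d.1, e.1⁆, ⁅d.1, e.2⁆ - ⁅e.1, d.2⁆))
    (by intros; ext <;> simp; ring) (by intros; ext <;> simp; ring)
    (by intros; ext <;> simp; ring) (by intros; ext <;> simp; ring)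

variable {𝔤}

/-- The map from `𝔤*` to `𝔤` defined by a bilinear form on `𝔤*`, so that
`ν (sharp β μ) = β μ ν`. -/
def sharp (β : LinearMap.BilinForm ℝ (Module.Dual ℝ 𝔤)) : Module.Dual ℝ 𝔤 →ₗ[ℝ] 𝔤 :=
  (Module.evalEquiv ℝ 𝔤).symm.toLinearMap ∘ₗ β

variable (𝔤)

/-- The semidirect product of `𝔤` and `𝔤*` over a point, which as a bundle over `𝔤` is the action
Lie algebroid of the abelian Lie algebra `𝔤*`, acting on `𝔤` by the constant vector fields
`sharp β μ`. -/
def model (β : LinearMap.BilinForm ℝ (Module.Dual ℝ 𝔤)) : Data 𝔤 (𝔤 × Module.Dual ℝ 𝔤) where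
  toDoubleVB := DoubleVB.directSum 𝔤 (Module.Dual ℝ 𝔤)
  courant := semidirect 𝔤
  anchor d := sharp β d.2
  bracket σ τ v := ⟨(v, dirDeriv (fun x => (τ x).1.2) v (sharp β (σ v).1.2)
    - dirDeriv (fun x => (σ x).1.2) v (sharp β (τ v).1.2)), rfl⟩

variable {𝔤}

/-- A Lie subalgebra is coisotropic for `β` if `sharp β` maps its annihilator into it. -/
def IsCoisotropicSubalgebra (β : LinearMap.BilinForm ℝ (Module.Dual ℝ 𝔤))
    (𝔥 : LieSubalgebra ℝ 𝔤) : Prop :=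
  ∀ μ ∈ 𝔥.toSubmodule.dualAnnihilator, sharp β μ ∈ 𝔥

end Model

end LACourant

end

/-!
A double vector bundle over a point splits canonically as `𝔸 = V ⊕ C`, with the zero section of
`𝔸 → V` as the inclusion of `V` and the core `C`, the kernel of the projection, as the other
summand.

Pairing and bracketing the elements `(x, x, x)`, `(c, c, 0)` and `(c, 0, c)` of the graph of the
fibrewise addition shows that `V` is an isotropic subalgebra and `C` an isotropic abelian ideal, so
that `C` is the dual of `V` and `𝔸` is the semidirect product `V ⋉ V*` for the coadjoint action.

Coisotropy of the annihilator of the graph of the addition of `𝔸` says that the anchor is additive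
on `𝔸` and that the constant sections of the core commute. The Leibniz rule then determines the
bracket, so that `𝔸 → V` is the action Lie algebroid of an abelian Lie algebra `C ≅ V*` acting by
constant vector fields. Its anchor is a linear map `V* → V`, that is, a bilinear form `β` on `V*`.

For such an action algebroid the relation `Π_𝔸` is the linear relation of the tangent prolongation
which swaps the core components by means of `β♯`. It is Lagrangian exactly when `β` is symmetric,
and then involutive exactly when `β♯` is equivariant, that is, when `β` is invariant.

A double vector subbundle is a direct sum of `W ⊆ V` and `K ⊆ V*`: it is a Dirac structure if and
only if `W` is a subalgebra and `K` its annihilator, and a Lie subalgebroid if and only if `β♯` maps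
`K` into `W`.
-/

noncomputable section

namespace LACourant

section Calculus

/-- The norm on a finite-dimensional real vector space given by linear coordinates; it gives access
to the library's calculus, and only serves inside proofs. -/
abbrev coordNorm (E : Type*) [AddCommGroup E] [Module ℝ E] [FiniteDimensional ℝ E] :
    NormedAddCommGroup E :=
  NormedAddCommGroup.induced E (Fin (Module.finrank ℝ E) → ℝ) (coords E) (coords E).injective

/-- The normed space structure for the norm given by linear coordinates. -/
abbrev coordNormedSpace (E : Type*) [AddCommGroup E] [Module ℝ E] [FiniteDimensional ℝ E] :
    @NormedSpace ℝ E _ (coordNorm E).toSeminormedAddCommGroup :=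
  letI := coordNorm E
  NormedSpace.induced ℝ E (Fin (Module.finrank ℝ E) → ℝ) (coords E)

section Normed

variable {E F : Type*} [NormedAddCommGroup E] [NormedSpace ℝ E]
  [NormedAddCommGroup F] [NormedSpace ℝ F] [FiniteDimensional ℝ F]

lemma smooth_iff_contDiff [FiniteDimensional ℝ E] (f : E → F) : Smooth f ↔ ContDiff ℝ ∞ f := by
  let e := (coords E).toContinuousLinearEquiv
  let e' := (coords F).toContinuousLinearEquiv
  have h : (fun x => coords F (f ((coords E).symm x))) = e' ∘ f ∘ e.symm := rfl
  rw [Smooth, h, e'.comp_contDiff_iff, e.symm.contDiff_comp_iff]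

lemma Smooth.differentiable [FiniteDimensional ℝ E] {f : E → F} (hf : Smooth f) :
    Differentiable ℝ f :=
  ((smooth_iff_contDiff f).1 hf).differentiable (by simp)

lemma dirDeriv_eq_fderiv {f : E → F} {x : E} (hf : DifferentiableAt ℝ f x) (h : E) :
    dirDeriv f x h = fderiv ℝ f x h := by
  let e' := (coords F).toContinuousLinearEquiv
  have hcoords :
      HasFDerivAt (fun y => coords F (f y)) (e'.toContinuousLinearMap ∘L fderiv ℝ f x) x :=
    e'.toContinuousLinearMap.hasFDerivAt.comp x hf.hasFDerivAt
  rw [dirDeriv, (hcoords.hasLineDerivAt h).lineDeriv]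
  exact (coords F).symm_apply_apply _

end Normed

variable {E F G H : Type*} [AddCommGroup E] [Module ℝ E] [FiniteDimensional ℝ E]
  [AddCommGroup F] [Module ℝ F] [FiniteDimensional ℝ F]
  [AddCommGroup G] [Module ℝ G] [FiniteDimensional ℝ G]
  [AddCommGroup H] [Module ℝ H] [FiniteDimensional ℝ H]

lemma Smooth.comp {g : F → G} {f : E → F} (hg : Smooth g) (hf : Smooth f) :
    Smooth (fun x => g (f x)) := by
  let := coordNorm E; let := coordNormedSpace E
  let := coordNorm F; let := coordNormedSpace F
  let := coordNorm G; let := coordNormedSpace G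
  rw [smooth_iff_contDiff] at *
  exact hg.comp hf

lemma smooth_const (c : F) : Smooth (fun _ : E => c) := by
  let := coordNorm E; let := coordNormedSpace E
  let := coordNorm F; let := coordNormedSpace F
  rw [smooth_iff_contDiff]
  exact contDiff_const

lemma Smooth.prodMk {f : E → F} {g : E → G} (hf : Smooth f) (hg : Smooth g) :
    Smooth (fun x => (f x, g x)) := by
  let := coordNorm E; let := coordNormedSpace E
  let := coordNorm F; let := coordNormedSpace F
  let := coordNorm G; let := coordNormedSpace G
  rw [smooth_iff_contDiff] at *
  exact hf.prodMk hg

lemma Smooth.linear_comp (l : F →ₗ[ℝ] G) {f : E → F} (hf : Smooth f) :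
    Smooth (fun x => l (f x)) :=
  (smooth_of_linear l).comp hf

lemma Smooth.add {f g : E → F} (hf : Smooth f) (hg : Smooth g) :
    Smooth (fun x => f x + g x) :=
  (hf.prodMk hg).linear_comp (LinearMap.fst ℝ F F + LinearMap.snd ℝ F F)

lemma Smooth.sub {f g : E → F} (hf : Smooth f) (hg : Smooth g) :
    Smooth (fun x => f x - g x) :=
  (hf.prodMk hg).linear_comp (LinearMap.fst ℝ F F - LinearMap.snd ℝ F F)

lemma Smooth.smul {f : E → ℝ} {g : E → F} (hf : Smooth f) (hg : Smooth g) :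
    Smooth (fun x => f x • g x) := by
  let := coordNorm E; let := coordNormedSpace E
  let := coordNorm F; let := coordNormedSpace F
  rw [smooth_iff_contDiff] at *
  exact hf.smul hg

lemma Smooth.dirDeriv {f : E → F} {X : E → E} (hf : Smooth f) (hX : Smooth X) :
    Smooth (fun x => dirDeriv f x (X x)) := by
  let := coordNorm E; let := coordNormedSpace E
  let := coordNorm F; let := coordNormedSpace F
  simp only [dirDeriv_eq_fderiv (hf.differentiable _)]
  rw [smooth_iff_contDiff] at *
  exact (hf.fderiv_right (m := ∞) (by simp)).clm_apply hX

lemma Smooth.isLinearMap_dirDeriv {f : E → F} (hf : Smooth f) (x : E) :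
    IsLinearMap ℝ (LACourant.dirDeriv f x) := by
  let := coordNorm E; let := coordNormedSpace E
  let := coordNorm F; let := coordNormedSpace F
  rw [funext (dirDeriv_eq_fderiv (hf.differentiable x))]
  exact (fderiv ℝ f x).toLinearMap.isLinear

lemma dirDeriv_add {f g : E → F} (hf : Smooth f) (hg : Smooth g) (x h : E) :
    dirDeriv (fun y => f y + g y) x h = dirDeriv f x h + dirDeriv g x h := by
  let := coordNorm E; let := coordNormedSpace E
  let := coordNorm F; let := coordNormedSpace F
  have hf' := hf.differentiable x
  have hg' := hg.differentiable x
  rw [dirDeriv_eq_fderiv hf', dirDeriv_eq_fderiv hg', dirDeriv_eq_fderiv (hf'.fun_add hg'),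
    fderiv_fun_add hf' hg']
  rfl

lemma dirDeriv_sub {f g : E → F} (hf : Smooth f) (hg : Smooth g) (x h : E) :
    dirDeriv (fun y => f y - g y) x h = dirDeriv f x h - dirDeriv g x h := by
  rw [eq_sub_iff_add_eq, ← dirDeriv_add (hf.sub hg) hg]
  simp only [sub_add_cancel]

lemma dirDeriv_smul {f : E → ℝ} {g : E → F} (hf : Smooth f) (hg : Smooth g) (x h : E) :
    dirDeriv (fun y => f y • g y) x h = dirDeriv f x h • g x + f x • dirDeriv g x h := by
  let := coordNorm E; let := coordNormedSpace E
  let := coordNorm F; let := coordNormedSpace F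
  have hf' := hf.differentiable x
  have hg' := hg.differentiable x
  rw [dirDeriv_eq_fderiv hf', dirDeriv_eq_fderiv hg', dirDeriv_eq_fderiv (hf'.fun_smul hg'),
    fderiv_fun_smul hf' hg']
  exact add_comm _ _

omit [FiniteDimensional ℝ E] in
lemma dirDeriv_const (c : F) (x h : E) : dirDeriv (fun _ : E => c) x h = 0 := by
  simp [dirDeriv, lineDeriv]

lemma dirDeriv_linear_comp (l : F →ₗ[ℝ] G) (m : E →ₗ[ℝ] H) {f : H → F} (hf : Smooth f)
    (x h : E) : dirDeriv (fun y => l (f (m y))) x h = l (dirDeriv f (m x) (m h)) := by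
  let := coordNorm E; let := coordNormedSpace E
  let := coordNorm F; let := coordNormedSpace F
  let := coordNorm G; let := coordNormedSpace G
  let := coordNorm H; let := coordNormedSpace H
  have hf' := hf.differentiable (m x)
  have hcomp : HasFDerivAt (fun y => l (f (m y)))
      (l.toContinuousLinearMap ∘L fderiv ℝ f (m x) ∘L m.toContinuousLinearMap) x :=
    l.toContinuousLinearMap.hasFDerivAt.comp x
      (hf'.hasFDerivAt.comp x m.toContinuousLinearMap.hasFDerivAt)
  rw [dirDeriv_eq_fderiv hf', dirDeriv_eq_fderiv hcomp.differentiableAt, hcomp.fderiv]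
  rfl

lemma dirDeriv_linear (l : E →ₗ[ℝ] F) (x h : E) : dirDeriv l x h = l h := by
  let := coordNorm E; let := coordNormedSpace E
  let := coordNorm F; let := coordNormedSpace F
  rw [dirDeriv_eq_fderiv (smooth_of_linear l).differentiable.differentiableAt]
  exact congrArg (· h) l.toContinuousLinearMap.fderiv

lemma lineDeriv_eq_dirDeriv {f : E → ℝ} (hf : Smooth f) (x h : E) :
    lineDeriv ℝ f x h = dirDeriv f x h := by
  let := coordNorm E; let := coordNormedSpace E
  have hf' := hf.differentiable x
  rw [dirDeriv_eq_fderiv hf', hf'.lineDeriv_eq_fderiv]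

lemma dirDeriv_commutator {f : E → F} {X Y : E → E} (hf : Smooth f) (hX : Smooth X)
    (hY : Smooth Y) (x : E) :
    dirDeriv f x (dirDeriv Y x (X x) - dirDeriv X x (Y x)) =
      dirDeriv (fun y => dirDeriv f y (Y y)) x (X x) -
        dirDeriv (fun y => dirDeriv f y (X y)) x (Y x) := by
  let := coordNorm E; let := coordNormedSpace E
  let := coordNorm F; let := coordNormedSpace F
  have hf₁ := (smooth_iff_contDiff f).1 hf
  have hf₂ : Differentiable ℝ (fderiv ℝ f) :=
    (hf₁.fderiv_right (m := ∞) (by simp)).differentiable (by simp)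
  have second_deriv {Z : E → E} (hZ : Smooth Z) (h : E) :
      dirDeriv (fun y => dirDeriv f y (Z y)) x h =
        fderiv ℝ (fderiv ℝ f) x h (Z x) + fderiv ℝ f x (dirDeriv Z x h) := by
    rw [dirDeriv_eq_fderiv ((hf.dirDeriv hZ).differentiable x)]
    simp only [dirDeriv_eq_fderiv (hf.differentiable _), dirDeriv_eq_fderiv (hZ.differentiable _)]
    rw [fderiv_clm_apply (hf₂ x) (hZ.differentiable x)]
    exact add_comm _ _
  have htwo : minSmoothness ℝ 2 ≤ ∞ := by
    simpa using (mod_cast le_top : ((2 : ℕ∞) : WithTop ℕ∞) ≤ ∞)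
  have hsymm : fderiv ℝ (fderiv ℝ f) x (X x) (Y x) = fderiv ℝ (fderiv ℝ f) x (Y x) (X x) :=
    (hf₁.contDiffAt.isSymmSndFDerivAt htwo).eq _ _
  rw [second_deriv hX, second_deriv hY, dirDeriv_eq_fderiv (hf.differentiable x), map_sub, hsymm]
  abel

lemma tangentVectors_submodule (N : Submodule ℝ E) {p : E} (hp : p ∈ N) :
    tangentVectors (N : Set E) p = N := by
  ext h
  constructor
  · rintro ⟨γ, hγ, hN, -, rfl⟩
    rw [SetLike.mem_coe, ← N.ker_mkQ, LinearMap.mem_ker,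
      ← LinearMap.id_apply (R := ℝ) (0 : ℝ), ← LinearMap.id_apply (R := ℝ) (1 : ℝ),
      ← dirDeriv_linear_comp N.mkQ LinearMap.id hγ]
    have hzero : (fun t => N.mkQ (γ (LinearMap.id (R := ℝ) t))) = fun _ => 0 :=
      funext fun t => by simpa using hN t
    rw [hzero, dirDeriv_const]
  · intro hh
    let l := LinearMap.toSpanSingleton ℝ E h
    refine ⟨fun t => p + l t, (smooth_const p).add (smooth_of_linear l),
      fun t => N.add_mem hp (N.smul_mem t hh), by simp [l], ?_⟩
    rw [dirDeriv_add (smooth_const p) (smooth_of_linear l), dirDeriv_const, dirDeriv_linear,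
      zero_add]
    exact one_smul ℝ h

lemma isCoisotropic_submodule {Cov : Type*} {ev : Cov → E → ℝ} {π : E → Cov → Cov → ℝ}
    (N : Submodule ℝ E) : IsCoisotropic ev π (N : Set E) ↔
      ∀ p ∈ N, ∀ α α' : Cov, (∀ h ∈ N, ev α h = 0) → (∀ h ∈ N, ev α' h = 0) → π p α α' = 0 := by
  refine forall₂_congr fun p hp => ?_
  simp only [tangentVectors_submodule N hp, SetLike.mem_coe]

/-- First-order differential operators on `F`-valued functions whose symbol is the vector field
`X`, such as the bracket with a fixed section of a Lie algebroid. -/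
structure IsDerivationAlong (X : E → E) (D : (E → F) → E → F) : Prop where
  map_add : ∀ s t, Smooth s → Smooth t → ∀ x, D (fun y => s y + t y) x = D s x + D t x
  leibniz : ∀ (f : E → ℝ) s, Smooth f → Smooth s → ∀ x,
    D (fun y => f y • s y) x = dirDeriv f x (X x) • s x + f x • D s x

lemma smooth_induction {P : (E → F) → Prop}
    (hsmul : ∀ (f : E → ℝ) (c : F), Smooth f → P (fun x => f x • c))
    (hadd : ∀ s t, Smooth s → Smooth t → P s → P t → P (fun x => s x + t x))
    {s : E → F} (hs : Smooth s) : P s := by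
  let b := Module.finBasis ℝ F
  have hcoord (i) : Smooth (fun x => b.coord i (s x)) := hs.linear_comp (b.coord i)
  have hsum : s = ∑ i, fun x => b.coord i (s x) • b i := by
    ext x
    simp [b.sum_repr]
  rw [hsum]
  exact (Finset.sum_induction _ (fun t => Smooth t ∧ P t)
    (fun t t' ht ht' => ⟨ht.1.add ht'.1, hadd t t' ht.1 ht'.1 ht.2 ht'.2⟩)
    ⟨smooth_const 0, by simpa [Pi.zero_def] using hsmul (fun _ => 0) 0 (smooth_const 0)⟩
    (fun i _ => ⟨(hcoord i).smul (smooth_const (b i)), hsmul _ _ (hcoord i)⟩)).2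

lemma IsDerivationAlong.eq_of_eq_on_const {X : E → E} {D D' : (E → F) → E → F}
    (hD : IsDerivationAlong X D) (hD' : IsDerivationAlong X D')
    (hconst : ∀ c x, D (fun _ => c) x = D' (fun _ => c) x) {s : E → F} (hs : Smooth s) (x : E) :
    D s x = D' s x := by
  refine smooth_induction (P := fun s => D s x = D' s x) (fun f c hf => ?_)
    (fun s t hs ht h h' => ?_) hs
  · rw [hD.leibniz f _ hf (smooth_const c), hD'.leibniz f _ hf (smooth_const c), hconst]
  · rw [hD.map_add s t hs ht, hD'.map_add s t hs ht, h, h']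

/-- The bracket of `F`-valued functions, regarded as sections of the action Lie algebroid of the
abelian Lie algebra `F` acting on `E` by the constant vector fields `a c`. -/
def actionBracket (a : F →ₗ[ℝ] E) (s t : E → F) (x : E) : F :=
  dirDeriv t x (a (s x)) - dirDeriv s x (a (t x))

lemma Smooth.actionBracket (a : F →ₗ[ℝ] E) {s t : E → F} (hs : Smooth s) (ht : Smooth t) :
    Smooth (actionBracket a s t) :=
  (ht.dirDeriv (hs.linear_comp a)).sub (hs.dirDeriv (ht.linear_comp a))

omit [FiniteDimensional ℝ E] in
lemma actionBracket_const (a : F →ₗ[ℝ] E) (c c' : F) (x : E) :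
    actionBracket a (fun _ => c) (fun _ => c') x = 0 := by
  simp [actionBracket, dirDeriv_const]

omit [FiniteDimensional ℝ E] in
lemma actionBracket_skew (a : F →ₗ[ℝ] E) (s t : E → F) (x : E) :
    actionBracket a s t x = -actionBracket a t s x :=
  (neg_sub _ _).symm

lemma isDerivationAlong_actionBracket (a : F →ₗ[ℝ] E) {s : E → F} (hs : Smooth s) :
    IsDerivationAlong (fun x => a (s x)) (actionBracket a s) where
  map_add t t' ht ht' x := by
    simp only [actionBracket, dirDeriv_add ht ht', map_add, (hs.isLinearMap_dirDeriv x).map_add]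
    abel
  leibniz f t hf ht x := by
    simp only [actionBracket, dirDeriv_smul hf ht, map_smul, (hs.isLinearMap_dirDeriv x).map_smul,
      smul_sub]
    abel

lemma dirDeriv_anchor_actionBracket (a : F →ₗ[ℝ] E) {s t : E → F} (hs : Smooth s) (ht : Smooth t)
    {f : E → G} (hf : Smooth f) (x : E) :
    dirDeriv f x (a (actionBracket a s t x)) =
      dirDeriv (fun y => dirDeriv f y (a (t y))) x (a (s x)) -
        dirDeriv (fun y => dirDeriv f y (a (s y))) x (a (t x)) := by
  have hconst (r : E → F) (hr : Smooth r) (h : E) :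
      a (dirDeriv r x h) = dirDeriv (fun y => a (r y)) x h :=
    (dirDeriv_linear_comp a LinearMap.id hr x h).symm
  rw [actionBracket, map_sub, hconst s hs, hconst t ht]
  exact dirDeriv_commutator hf (hs.linear_comp a) (ht.linear_comp a) x

lemma actionBracket_jacobi (a : F →ₗ[ℝ] E) {s t r : E → F} (hs : Smooth s) (ht : Smooth t)
    (hr : Smooth r) (x : E) : actionBracket a s (actionBracket a t r) x =
      actionBracket a (actionBracket a s t) r x + actionBracket a t (actionBracket a s r) x := by
  have expand {u v w : E → F} (hu : Smooth u) (hv : Smooth v) (hw : Smooth w) :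
      actionBracket a u (actionBracket a v w) x =
        (dirDeriv (fun y => dirDeriv w y (a (v y))) x (a (u x)) -
            dirDeriv (fun y => dirDeriv v y (a (w y))) x (a (u x))) -
          (dirDeriv (fun y => dirDeriv u y (a (w y))) x (a (v x)) -
            dirDeriv (fun y => dirDeriv u y (a (v y))) x (a (w x))) := by
    rw [← dirDeriv_anchor_actionBracket a hv hw hu,
      ← dirDeriv_sub (hw.dirDeriv (hv.linear_comp a)) (hv.dirDeriv (hw.linear_comp a))]
    rfl
  rw [actionBracket_skew a (actionBracket a s t), expand hs ht hr, expand hr hs ht, expand ht hs hr]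
  abel

lemma map_actionBracket {a : F →ₗ[ℝ] E} {b : G →ₗ[ℝ] H} {l : F →ₗ[ℝ] G} {m : E →ₗ[ℝ] H}
    (hab : ∀ c, m (a c) = b (l c)) {s t : E → F} {s' t' : H → G} (hs : Smooth s) (ht : Smooth t)
    (hs' : Smooth s') (ht' : Smooth t') (hss' : ∀ x, l (s x) = s' (m x))
    (htt' : ∀ x, l (t x) = t' (m x)) (x : E) :
    l (actionBracket a s t x) = actionBracket b s' t' (m x) := by
  have map_dirDeriv {r : E → F} {r' : H → G} (hr : Smooth r) (hr' : Smooth r')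
      (hrr' : ∀ x, l (r x) = r' (m x)) (h : E) :
      l (dirDeriv r x h) = dirDeriv r' (m x) (m h) := by
    have hl := dirDeriv_linear_comp l LinearMap.id hr x h
    have hm := dirDeriv_linear_comp LinearMap.id m hr' x h
    simp only [LinearMap.id_apply] at hl hm
    rw [← hl, ← hm, funext hrr']
  rw [actionBracket, actionBracket, map_sub, map_dirDeriv ht ht' htt', map_dirDeriv hs hs' hss',
    hab, hab, hss', htt']

/-- The Leibniz rule in each of the arguments reduces the claim to constant sections. -/
lemma eq_actionBracket {a : F →ₗ[ℝ] E} {B : (E → F) → (E → F) → E → F}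
    (hB : ∀ s, Smooth s → IsDerivationAlong (fun x => a (s x)) (B s))
    (hskew : ∀ s t, Smooth s → Smooth t → ∀ x, B s t x = -B t s x)
    (hconst : ∀ c c' x, B (fun _ => c) (fun _ => c') x = 0)
    {s t : E → F} (hs : Smooth s) (ht : Smooth t) (x : E) : B s t x = actionBracket a s t x := by
  refine (hB s hs).eq_of_eq_on_const (isDerivationAlong_actionBracket a hs) (fun c x => ?_) ht x
  have hc := smooth_const (E := E) c
  rw [hskew _ _ hs hc, actionBracket_skew, neg_inj]
  refine (hB _ hc).eq_of_eq_on_const (isDerivationAlong_actionBracket a hc) (fun c' x => ?_) hs x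
  rw [hconst, actionBracket_const]

end Calculus

lemma eq_of_forall_dual_apply_eq {E : Type*} [AddCommGroup E] [Module ℝ E] {x y : E}
    (h : ∀ f : Module.Dual ℝ E, f x = f y) : x = y :=
  sub_eq_zero.1 ((Module.forall_dual_apply_eq_zero_iff ℝ _).1 fun f => by
    rw [map_sub, h f, sub_self])

namespace MetricBracket

variable {E F E' F' : Type*} [AddCommGroup E] [Module ℝ E] [AddCommGroup F] [Module ℝ F]
  [AddCommGroup E'] [Module ℝ E'] [AddCommGroup F'] [Module ℝ F']
  {Q : MetricBracket E} {R : MetricBracket F} {Q' : MetricBracket E'} {R' : MetricBracket F'}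

lemma prod_metric (x y : E × F) :
    (Q.prod R).metric x y = Q.metric x.1 y.1 + R.metric x.2 y.2 := rfl

lemma prod_bracket (x y : E × F) :
    (Q.prod R).bracket x y = (Q.bracket x.1 y.1, R.bracket x.2 y.2) := rfl

lemma prod_bar_metric (x y : E × F) :
    (Q.prod R.bar).metric x y = Q.metric x.1 y.1 - R.metric x.2 y.2 :=
  (sub_eq_add_neg _ _).symm

lemma bar_bracket (x y : E) : Q.bar.bracket x y = Q.bracket x y := rfl

lemma tangent_metric (x y : E × E) :
    Q.tangent.metric x y = Q.metric x.1 y.2 + Q.metric x.2 y.1 := rfl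

lemma tangent_bracket (x y : E × E) :
    Q.tangent.bracket x y = (Q.bracket x.1 y.1, Q.bracket x.1 y.2 + Q.bracket x.2 y.1) := rfl

/-- The linear equivalence `f` is an isomorphism for the metrics and the brackets. -/
structure IsIso (Q : MetricBracket E) (R : MetricBracket F) (f : E ≃ₗ[ℝ] F) : Prop where
  map_metric : ∀ x y, R.metric (f x) (f y) = Q.metric x y
  map_bracket : ∀ x y, R.bracket (f x) (f y) = f (Q.bracket x y)

namespace IsIso

variable {f : E ≃ₗ[ℝ] E'} {g : F ≃ₗ[ℝ] F'}

lemma bar (h : Q.IsIso Q' f) : Q.bar.IsIso Q'.bar f where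
  map_metric x y := congrArg Neg.neg (h.map_metric x y)
  map_bracket := h.map_bracket

lemma prod (hQ : Q.IsIso Q' f) (hR : R.IsIso R' g) :
    (Q.prod R).IsIso (Q'.prod R') (f.prodCongr g) where
  map_metric x y := congrArg₂ (· + ·) (hQ.map_metric x.1 y.1) (hR.map_metric x.2 y.2)
  map_bracket x y := Prod.ext (hQ.map_bracket x.1 y.1) (hR.map_bracket x.2 y.2)

lemma tangent (h : Q.IsIso Q' f) : Q.tangent.IsIso Q'.tangent (f.prodCongr f) where
  map_metric x y := congrArg₂ (· + ·) (h.map_metric x.1 y.2) (h.map_metric x.2 y.1)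
  map_bracket x y := Prod.ext (h.map_bracket x.1 y.1) (by
    simp only [tangent_bracket, LinearEquiv.prodCongr_apply, h.map_bracket, map_add])

lemma isCourantAlgebroid (h : Q.IsIso Q' f) (hQ' : Q'.IsCourantAlgebroid) :
    Q.IsCourantAlgebroid where
  metric_symm x y := by rw [← h.map_metric, ← h.map_metric, hQ'.metric_symm]
  metric_nondegenerate x hx := f.map_eq_zero_iff.1 (hQ'.metric_nondegenerate _ fun y => by
    rw [← f.apply_symm_apply y, h.map_metric, hx])
  jacobi x y z := f.injective (by simp only [map_add, ← h.map_bracket, ← hQ'.jacobi])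
  metric_invariant x y z := by
    simp only [← h.map_metric, ← h.map_bracket, ← hQ'.metric_invariant]
  bracket_add_swap x y := f.injective (by
    rw [map_add, ← h.map_bracket, ← h.map_bracket, hQ'.bracket_add_swap, map_zero])

lemma isDirac_preimage_iff (h : Q.IsIso Q' f) {L : Set E'} :
    Q.IsDirac (f ⁻¹' L) ↔ Q'.IsDirac L := by
  constructor <;> rintro ⟨hlagrangian, hinvolutive⟩
  · refine ⟨f.surjective.forall.2 fun x => ?_, f.surjective.forall.2 fun x hx =>
      f.surjective.forall.2 fun y hy => ?_⟩
    · simpa only [Set.mem_preimage, f.surjective.forall, h.map_metric] using hlagrangian x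
    · rw [h.map_bracket]
      exact hinvolutive x hx y hy
  · refine ⟨fun x => ?_, fun x hx y hy => ?_⟩
    · simpa only [Set.mem_preimage, f.surjective.forall, h.map_metric] using hlagrangian (f x)
    · rw [Set.mem_preimage, ← h.map_bracket]
      exact hinvolutive _ hx _ hy

lemma isCourantRelation_preimage_iff (hQ : Q.IsIso Q' f) (hR : R.IsIso R' g)
    {rel : Set (F' × E')} :
    Q.IsCourantRelation R (g.prodCongr f ⁻¹' rel) ↔ Q'.IsCourantRelation R' rel :=
  (hR.prod hQ.bar).isDirac_preimage_iff

end IsIso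

end MetricBracket

section Semidirect

variable {𝔤 : Type*} [LieRing 𝔤] [LieAlgebra ℝ 𝔤]

lemma semidirect_metric (d e : 𝔤 × Module.Dual ℝ 𝔤) :
    (semidirect 𝔤).metric d e = d.2 e.1 + e.2 d.1 := rfl

lemma semidirect_bracket (d e : 𝔤 × Module.Dual ℝ 𝔤) :
    (semidirect 𝔤).bracket d e = (⁅d.1, e.1⁆, ⁅d.1, e.2⁆ - ⁅e.1, d.2⁆) := rfl

lemma semidirect_isCourantAlgebroid : (semidirect 𝔤).IsCourantAlgebroid where
  metric_symm x y := add_comm _ _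
  metric_nondegenerate x h := by
    refine Prod.ext (eq_of_forall_dual_apply_eq fun f => ?_) (LinearMap.ext fun y => ?_)
    · simpa [semidirect_metric] using h (0, f)
    · simpa [semidirect_metric] using h (y, 0)
  jacobi x y z := by
    simp only [semidirect_bracket]
    refine Prod.ext (leibniz_lie _ _ _) ?_
    simp only [lie_sub, lie_lie, Prod.snd_add]
    abel
  metric_invariant x y z := by
    simp only [semidirect_metric, semidirect_bracket, LinearMap.sub_apply, Module.Dual.lie_apply]
    rw [← lie_skew z.1 y.1, map_neg]
    ring
  bracket_add_swap x y := by
    refine Prod.ext ?_ ?_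
    · exact add_eq_zero_iff_eq_neg.2 (lie_skew _ _).symm
    · simp only [semidirect_bracket, Prod.snd_add, Prod.snd_zero]
      abel

lemma semidirect_isCourantRelation_fibreAdd :
    ((semidirect 𝔤).prod (semidirect 𝔤)).IsCourantRelation (semidirect 𝔤)
      {z | z.2.1.1 = z.1.1 ∧ z.2.2.1 = z.1.1 ∧ z.1.2 = z.2.1.2 + z.2.2.2} where
  lagrangian := by
    rintro ⟨⟨x, μ⟩, ⟨x₁, μ₁⟩, ⟨x₂, μ₂⟩⟩
    simp only [Set.mem_ofPred_eq, MetricBracket.prod_bar_metric]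
    simp only [MetricBracket.prod_metric, semidirect_metric]
    constructor
    · rintro ⟨rfl, rfl, rfl⟩ ⟨⟨y, ν⟩, ⟨y₁, ν₁⟩, ⟨y₂, ν₂⟩⟩ ⟨h₁, h₂, hν⟩
      simp only at h₁ h₂ hν
      subst h₁ h₂ hν
      simp only [LinearMap.add_apply]
      ring
    · intro h
      refine ⟨eq_of_forall_dual_apply_eq fun ν => ?_, eq_of_forall_dual_apply_eq fun ν => ?_,
        LinearMap.ext fun y => ?_⟩
      · have hν := h ((0, ν), (0, ν), (0, 0)) (by simp)
        simp only [map_zero, LinearMap.zero_apply] at hν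
        linarith
      · have hν := h ((0, ν), (0, 0), (0, ν)) (by simp)
        simp only [map_zero, LinearMap.zero_apply] at hν
        linarith
      · have hy := h ((y, 0), (y, 0), (y, 0)) (by simp)
        simp only [LinearMap.zero_apply] at hy
        rw [LinearMap.add_apply]
        linarith
  involutive := by
    rintro ⟨⟨x, μ⟩, ⟨x₁, μ₁⟩, ⟨x₂, μ₂⟩⟩ h ⟨⟨y, ν⟩, ⟨y₁, ν₁⟩, ⟨y₂, ν₂⟩⟩ h'
    obtain ⟨hx₁, hx₂, hμ⟩ := h
    obtain ⟨hy₁, hy₂, hν⟩ := h'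
    simp only at hx₁ hx₂ hμ hy₁ hy₂ hν
    subst hx₁ hx₂ hμ hy₁ hy₂ hν
    refine ⟨rfl, rfl, ?_⟩
    simp only [MetricBracket.prod_bracket, MetricBracket.bar_bracket, semidirect_bracket, lie_add]
    abel

lemma semidirect_isDirac_prod_iff {W : Submodule ℝ 𝔤} {K : Submodule ℝ (Module.Dual ℝ 𝔤)} :
    (semidirect 𝔤).IsDirac ((W : Set 𝔤) ×ˢ (K : Set (Module.Dual ℝ 𝔤))) ↔
      K = W.dualAnnihilator ∧ ∀ x ∈ W, ∀ y ∈ W, ⁅x, y⁆ ∈ W := by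
  constructor
  · intro h
    refine ⟨Submodule.ext fun μ => ?_,
      fun x hx y hy => (h.involutive (x, 0) ⟨hx, K.zero_mem⟩ (y, 0) ⟨hy, K.zero_mem⟩).1⟩
    have hμ := h.lagrangian (0, μ)
    simp only [semidirect_metric, map_zero, add_zero] at hμ
    rw [Submodule.mem_dualAnnihilator]
    exact ⟨fun hμK x hx => hμ.1 ⟨W.zero_mem, hμK⟩ (x, 0) ⟨hx, K.zero_mem⟩,
      fun hμW => (hμ.2 fun d hd => hμW d.1 hd.1).2⟩
  · rintro ⟨rfl, hlie⟩
    refine ⟨fun ⟨x, μ⟩ => ⟨?_, fun h => ⟨?_, ?_⟩⟩, ?_⟩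
    · rintro ⟨hx, hμ⟩ ⟨y, ν⟩ ⟨hy, hν⟩
      rw [semidirect_metric, (Submodule.mem_dualAnnihilator _).1 hμ y hy,
        (Submodule.mem_dualAnnihilator _).1 hν x hx, add_zero]
    · refine (Subspace.forall_mem_dualAnnihilator_apply_eq_zero_iff _ _).1 fun ν hν => ?_
      simpa [semidirect_metric] using h (0, ν) ⟨W.zero_mem, hν⟩
    · refine (Submodule.mem_dualAnnihilator _).2 fun y hy => ?_
      simpa [semidirect_metric] using h (y, 0) ⟨hy, zero_mem _⟩
    · rintro ⟨x, μ⟩ ⟨hx, hμ⟩ ⟨y, ν⟩ ⟨hy, hν⟩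
      refine ⟨hlie x hx y hy, (Submodule.mem_dualAnnihilator _).2 fun z hz => ?_⟩
      rw [semidirect_bracket, LinearMap.sub_apply, Module.Dual.lie_apply, Module.Dual.lie_apply,
        (Submodule.mem_dualAnnihilator _).1 hν _ (hlie x hx z hz),
        (Submodule.mem_dualAnnihilator _).1 hμ _ (hlie y hy z hz), sub_self]

lemma semidirect_isIso_iff {𝔤' : Type*} [LieRing 𝔤'] [LieAlgebra ℝ 𝔤'] {φ : 𝔤 ≃ₗ[ℝ] 𝔤'}
    {Φ : (𝔤 × Module.Dual ℝ 𝔤) ≃ₗ[ℝ] 𝔤' × Module.Dual ℝ 𝔤'} :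
    ((∀ d, (Φ d).1 = φ d.1) ∧ (∀ x, Φ (x, 0) = (φ x, 0)) ∧
      (semidirect 𝔤).IsIso (semidirect 𝔤') Φ) ↔
      (∀ x y, φ ⁅x, y⁆ = ⁅φ x, φ y⁆) ∧ ∀ x μ, Φ (x, μ) = (φ x, μ ∘ₗ φ.symm.toLinearMap) := by
  constructor
  · rintro ⟨hproj, hzero, hΦ⟩
    refine ⟨fun x y => ?_, fun x μ => Prod.ext (hproj (x, μ)) (LinearMap.ext fun y => ?_)⟩
    · have hbracket := hΦ.map_bracket (x, 0) (y, 0)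
      rw [hzero, hzero] at hbracket
      exact (hproj _).symm.trans (congrArg Prod.fst hbracket).symm
    · have hmetric := hΦ.map_metric (x, μ) (φ.symm y, 0)
      rw [hzero] at hmetric
      simpa [semidirect_metric] using hmetric
  · rintro ⟨hφ, hΦ⟩
    have hφsymm (x y : 𝔤') : φ.symm ⁅x, y⁆ = ⁅φ.symm x, φ.symm y⁆ :=
      φ.injective (by rw [hφ]; simp only [LinearEquiv.apply_symm_apply])
    refine ⟨fun d => by rw [hΦ d.1 d.2], fun x => by rw [hΦ, LinearMap.zero_comp], ?_, ?_⟩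
    · rintro ⟨x, μ⟩ ⟨y, ν⟩
      simp [hΦ, semidirect_metric]
    · rintro ⟨x, μ⟩ ⟨y, ν⟩
      simp only [hΦ, semidirect_bracket, hφ]
      refine Prod.ext rfl (LinearMap.ext fun z => ?_)
      simp [hφsymm]

section Sharp

variable [FiniteDimensional ℝ 𝔤] {β : LinearMap.BilinForm ℝ (Module.Dual ℝ 𝔤)}

lemma apply_sharp (β : LinearMap.BilinForm ℝ (Module.Dual ℝ 𝔤)) (μ ν : Module.Dual ℝ 𝔤) :
    ν (sharp β μ) = β μ ν :=
  Module.apply_evalEquiv_symm_apply ℝ 𝔤 ν (β μ)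

lemma exists_sharp_eq (a : Module.Dual ℝ 𝔤 →ₗ[ℝ] 𝔤) : ∃ β, sharp β = a :=
  ⟨(Module.evalEquiv ℝ 𝔤).toLinearMap ∘ₗ a, LinearMap.ext fun _ =>
    (Module.evalEquiv ℝ 𝔤).symm_apply_apply _⟩

lemma sharp_eq_map_sharp_iff {𝔤' : Type*} [LieRing 𝔤'] [LieAlgebra ℝ 𝔤'] [FiniteDimensional ℝ 𝔤']
    {β' : LinearMap.BilinForm ℝ (Module.Dual ℝ 𝔤')} {φ : 𝔤 →ₗ[ℝ] 𝔤'} :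
    (∀ μ, sharp β' μ = φ (sharp β (μ ∘ₗ φ))) ↔ ∀ μ ν, β' μ ν = β (μ ∘ₗ φ) (ν ∘ₗ φ) := by
  refine forall_congr' fun μ => ⟨fun h ν => ?_, fun h => eq_of_forall_dual_apply_eq fun ν => ?_⟩
  · rw [← apply_sharp, h, ← apply_sharp, LinearMap.comp_apply]
  · rw [apply_sharp, h, ← apply_sharp, LinearMap.comp_apply]

lemma lieInvariant_iff_sharp_lie :
    β.lieInvariant 𝔤 ↔ ∀ (x : 𝔤) (μ : Module.Dual ℝ 𝔤), sharp β ⁅x, μ⁆ = ⁅x, sharp β μ⁆ := by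
  refine forall₂_congr fun x μ => ⟨fun h => eq_of_forall_dual_apply_eq fun ν => ?_, fun h ν => ?_⟩
  · rw [apply_sharp, h ν, ← apply_sharp, Module.Dual.lie_apply, neg_neg]
  · rw [← apply_sharp, h, ← apply_sharp, Module.Dual.lie_apply, neg_neg]

lemma sharp_lie_swap (hsymm : β.IsSymm) (hinv : β.lieInvariant 𝔤) (μ ν : Module.Dual ℝ 𝔤) :
    ⁅sharp β μ, ν⁆ = -⁅sharp β ν, μ⁆ := by
  ext x
  have hsharp := lieInvariant_iff_sharp_lie.1 hinv x
  rw [LinearMap.neg_apply, Module.Dual.lie_apply, Module.Dual.lie_apply, ← lie_skew,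
    ← lie_skew _ x, map_neg, map_neg, ← hsharp, ← hsharp, apply_sharp, apply_sharp,
    hinv x μ ν, ← hsymm.eq]

/-- The relation `T(𝔤 ⋉ 𝔤*) ⇢ T(𝔤 ⋉ 𝔤*)` dual to the Poisson anchor map of the action Lie
algebroid with anchor `sharp β`; its elements are pairs (target, source) of tangent vectors, each
of which is a pair (base point, velocity). -/
def sharpRelation (β : LinearMap.BilinForm ℝ (Module.Dual ℝ 𝔤)) :
    Set (((𝔤 × Module.Dual ℝ 𝔤) × (𝔤 × Module.Dual ℝ 𝔤)) ×
      ((𝔤 × Module.Dual ℝ 𝔤) × (𝔤 × Module.Dual ℝ 𝔤))) :=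
  {w | (w.1.1.1 = w.2.1.1 ∧ w.1.2.1 = sharp β w.2.1.2) ∧
    w.2.2.1 = sharp β w.1.1.2 ∧ w.1.2.2 = w.2.2.2}

lemma mem_sharpRelation_source (β : LinearMap.BilinForm ℝ (Module.Dual ℝ 𝔤))
    (μ : Module.Dual ℝ 𝔤) : (((0, 0), (sharp β μ, 0)), ((0, μ), (0, 0))) ∈ sharpRelation β := by
  simp [sharpRelation]

lemma mem_sharpRelation_target (β : LinearMap.BilinForm ℝ (Module.Dual ℝ 𝔤))
    (μ : Module.Dual ℝ 𝔤) : (((0, μ), (0, 0)), ((0, 0), (sharp β μ, 0))) ∈ sharpRelation β := by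
  simp [sharpRelation]

lemma mem_sharpRelation_diag (β : LinearMap.BilinForm ℝ (Module.Dual ℝ 𝔤)) (x : 𝔤) :
    (((x, 0), (0, 0)), ((x, 0), (0, 0))) ∈ sharpRelation β := by
  simp [sharpRelation]

lemma mem_sharpRelation_iff_forall_metric_eq_zero (hsymm : β.IsSymm)
    (w : ((𝔤 × Module.Dual ℝ 𝔤) × (𝔤 × Module.Dual ℝ 𝔤)) ×
      ((𝔤 × Module.Dual ℝ 𝔤) × (𝔤 × Module.Dual ℝ 𝔤))) :
    w ∈ sharpRelation β ↔ ∀ w' ∈ sharpRelation β,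
      ((semidirect 𝔤).tangent.prod (semidirect 𝔤).tangent.bar).metric w w' = 0 := by
  have apply_sharp_comm (μ ν : Module.Dual ℝ 𝔤) : ν (sharp β μ) = μ (sharp β ν) := by
    rw [apply_sharp, apply_sharp, ← hsymm.eq]
  obtain ⟨⟨⟨x, μ⟩, ⟨x', μ'⟩⟩, ⟨⟨y, ν⟩, ⟨y', ν'⟩⟩⟩ := w
  simp only [MetricBracket.prod_bar_metric, MetricBracket.tangent_metric, semidirect_metric]
  constructor
  · rintro ⟨⟨h₁, h₂⟩, h₃, h₄⟩ ⟨⟨⟨z, ξ⟩, ⟨z', ξ'⟩⟩, ⟨⟨t, η⟩, ⟨t', η'⟩⟩⟩ ⟨⟨h₁', h₂'⟩, h₃', h₄'⟩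
    simp only at h₁ h₂ h₃ h₄ h₁' h₂' h₃' h₄'
    subst h₁ h₂ h₃ h₄ h₁' h₂' h₃' h₄'
    simp only
    rw [apply_sharp_comm ν ξ, apply_sharp_comm η μ]
    ring
  · intro h
    refine ⟨⟨?_, ?_⟩, ?_, LinearMap.ext fun z => ?_⟩
    · refine eq_of_forall_dual_apply_eq fun ξ => ?_
      have hξ := h (((0, 0), (0, ξ)), ((0, 0), (0, ξ))) (by simp [sharpRelation])
      simp only [map_zero, LinearMap.zero_apply] at hξ
      linarith
    · refine eq_of_forall_dual_apply_eq fun ξ => ?_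
      have hξ := h _ (mem_sharpRelation_target β ξ)
      simp only [map_zero, LinearMap.zero_apply] at hξ
      rw [apply_sharp_comm ν ξ]
      linarith
    · refine eq_of_forall_dual_apply_eq fun ξ => ?_
      have hξ := h _ (mem_sharpRelation_source β ξ)
      simp only [map_zero, LinearMap.zero_apply] at hξ
      rw [apply_sharp_comm μ ξ]
      linarith
    · have hz := h _ (mem_sharpRelation_diag β z)
      simp only [map_zero, LinearMap.zero_apply] at hz
      linarith

lemma bracket_mem_sharpRelation (hsymm : β.IsSymm) (hinv : β.lieInvariant 𝔤)
    {w w' : ((𝔤 × Module.Dual ℝ 𝔤) × (𝔤 × Module.Dual ℝ 𝔤)) ×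
      ((𝔤 × Module.Dual ℝ 𝔤) × (𝔤 × Module.Dual ℝ 𝔤))}
    (hw : w ∈ sharpRelation β) (hw' : w' ∈ sharpRelation β) :
    ((semidirect 𝔤).tangent.prod (semidirect 𝔤).tangent.bar).bracket w w' ∈ sharpRelation β := by
  have hsharp := lieInvariant_iff_sharp_lie.1 hinv
  obtain ⟨⟨⟨x, μ⟩, ⟨x', μ'⟩⟩, ⟨⟨y, ν⟩, ⟨y', ν'⟩⟩⟩ := w
  obtain ⟨⟨⟨z, ξ⟩, ⟨z', ξ'⟩⟩, ⟨⟨t, η⟩, ⟨t', η'⟩⟩⟩ := w'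
  obtain ⟨⟨h₁, h₂⟩, h₃, h₄⟩ := hw
  obtain ⟨⟨h₁', h₂'⟩, h₃', h₄'⟩ := hw'
  simp only at h₁ h₂ h₃ h₄ h₁' h₂' h₃' h₄'
  subst h₁ h₂ h₃ h₄ h₁' h₂' h₃' h₄'
  simp only [sharpRelation, Set.mem_ofPred_eq, MetricBracket.prod_bracket,
    MetricBracket.bar_bracket, MetricBracket.tangent_bracket, semidirect_bracket, true_and,
    map_sub, hsharp, Prod.fst_add, Prod.snd_add]
  refine ⟨?_, ?_, ?_⟩
  · rw [← lie_skew _ z]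
    abel
  · rw [← lie_skew _ z]
    abel
  · rw [sharp_lie_swap hsymm hinv η μ, sharp_lie_swap hsymm hinv ν ξ]
    abel

theorem isCourantRelation_sharpRelation_iff :
    (semidirect 𝔤).tangent.IsCourantRelation (semidirect 𝔤).tangent (sharpRelation β) ↔
      β.IsSymm ∧ β.lieInvariant 𝔤 := by
  refine ⟨fun h => ⟨⟨fun μ ν => ?_⟩, lieInvariant_iff_sharp_lie.2 fun x μ => ?_⟩,
    fun h => ⟨mem_sharpRelation_iff_forall_metric_eq_zero h.1,
      fun _ hw _ hw' => bracket_mem_sharpRelation h.1 h.2 hw hw'⟩⟩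
  · have hmetric := (h.lagrangian _).1 (mem_sharpRelation_source β μ) _
      (mem_sharpRelation_target β ν)
    simp only [MetricBracket.prod_bar_metric, MetricBracket.tangent_metric, semidirect_metric,
      map_zero, apply_sharp] at hmetric
    linarith
  · have hbracket := h.involutive _ (mem_sharpRelation_diag β x) _ (mem_sharpRelation_source β μ)
    simpa [MetricBracket.prod_bracket, MetricBracket.bar_bracket, MetricBracket.tangent_bracket,
      semidirect_bracket] using hbracket.1.2.symm

end Sharp

end Semidirect

namespace DoubleVB

variable {V : Type*} {𝔸 : Type*} [AddCommGroup V] [Module ℝ V] [FiniteDimensional ℝ V]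
  [AddCommGroup 𝔸] [Module ℝ 𝔸] [FiniteDimensional ℝ 𝔸] (D : DoubleVB V 𝔸)

lemma coe_add_cast {v w : V} (h : v = w) (x y : D.Fibre v) :
    ((x + y : D.Fibre v) : 𝔸) =
      ((⟨x, x.2.trans h⟩ + ⟨y, y.2.trans h⟩ : D.Fibre w) : 𝔸) := by
  subst h; rfl

lemma coe_smul_cast {v w : V} (h : v = w) (t : ℝ) (x : D.Fibre v) :
    ((t • x : D.Fibre v) : 𝔸) = ((t • ⟨x, x.2.trans h⟩ : D.Fibre w) : 𝔸) := by
  subst h; rfl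

/-- The zero section of `𝔸 → V`, which is linear by the interchange laws. -/
def zeroSection : V →ₗ[ℝ] 𝔸 where
  toFun v := (0 : D.Fibre v)
  map_add' v v' := by
    have hadd := D.add_interchange v v' 0 0 0 0
    simp only [add_zero] at hadd
    exact (congrArg Subtype.val (left_eq_add.1 (Subtype.ext hadd : (⟨_, _⟩ : D.Fibre (v + v')) =
      _))).symm
  map_smul' t v := by
    have hadd := D.smul_interchange t v 0 0
    simp only [add_zero] at hadd
    exact (congrArg Subtype.val (left_eq_add.1 (Subtype.ext hadd : (⟨_, _⟩ : D.Fibre (t • v)) =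
      _))).symm

lemma coe_zero (v : V) : ((0 : D.Fibre v) : 𝔸) = D.zeroSection v := rfl

@[simp] lemma proj_zeroSection (v : V) : D.proj (D.zeroSection v) = v := (0 : D.Fibre v).2

lemma coe_add {v : V} (x y : D.Fibre v) :
    ((x + y : D.Fibre v) : 𝔸) = x + y - D.zeroSection v := by
  have h := D.add_interchange v 0 x 0 0 ⟨y - D.zeroSection v, by simp [y.2]⟩
  rw [D.coe_add_cast (add_zero v)] at h
  simp only [add_zero, zero_add, D.coe_zero, map_zero, add_sub_cancel] at h
  rw [add_sub_assoc, h]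

/-- The interchange laws only show that the multiplication by `t` in the fibre over `0` and in `𝔸`
agree for rational `t`; the local triviality gives the continuity which settles the general case. -/
lemma coe_smul_zero (t : ℝ) (c : D.Fibre 0) : ((t • c : D.Fibre 0) : 𝔸) = t • (c : 𝔸) := by
  obtain ⟨U, n, φ, -, h0, -, hφ⟩ := D.locally_trivial 0
  let ψ : (Fin n → ℝ) →+ (Fin (Module.finrank ℝ 𝔸) → ℝ) :=
    { toFun w := coords 𝔸 ((φ 0).symm w)
      map_zero' := by rw [map_zero, D.coe_zero, map_zero, map_zero]
      map_add' w w' := by rw [map_add, D.coe_add, map_zero, sub_zero, map_add] }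
  have hψ : Continuous ψ := by
    let ι : (Fin n → ℝ) →ₗ[ℝ] _ :=
      (coords (V × (Fin n → ℝ))).toLinearMap ∘ₗ LinearMap.inr ℝ V (Fin n → ℝ)
    have hcont := hφ.continuousOn.comp_continuous (f := ι) ι.continuous_of_finiteDimensional
      (fun w => by simpa [ι] using h0)
    exact hcont.congr fun w => congrArg
      (fun p : V × (Fin n → ℝ) => coords 𝔸 ((φ p.1).symm p.2 : 𝔸))
      ((coords (V × (Fin n → ℝ))).symm_apply_apply (0, w))
  have hsmul : coords 𝔸 ((φ 0).symm (t • φ 0 c)) = t • coords 𝔸 ((φ 0).symm (φ 0 c)) :=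
    map_real_smul ψ hψ t (φ 0 c)
  rw [map_smul, LinearEquiv.symm_apply_apply, ← map_smul] at hsmul
  exact (coords 𝔸).injective hsmul

lemma coe_smul {v : V} (t : ℝ) (x : D.Fibre v) :
    ((t • x : D.Fibre v) : 𝔸) = D.zeroSection v + t • ((x : 𝔸) - D.zeroSection v) := by
  have h := D.fibre_smul_interchange t v 0 0 ⟨x - D.zeroSection v, by simp [x.2]⟩
  rw [D.coe_smul_cast (add_zero v)] at h
  simp only [smul_zero, D.coe_zero, add_sub_cancel] at h
  rw [h, D.coe_smul_zero]

lemma coe_corePart (d : 𝔸) : (D.corePart d : 𝔸) = d - D.zeroSection (D.proj d) := rfl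

lemma coe_coreSection (c : D.Core) (v : V) : (D.coreSection c v : 𝔸) = D.zeroSection v + c := rfl

lemma zeroSection_add_corePart (d : 𝔸) : D.zeroSection (D.proj d) + D.corePart d = d := by
  rw [coe_corePart, add_sub_cancel]

@[simp] lemma proj_core (c : D.Core) : D.proj c = 0 := LinearMap.mem_ker.1 c.2

/-- The core component, as a linear map. -/
def coreMap : 𝔸 →ₗ[ℝ] D.Core where
  toFun := D.corePart
  map_add' d e := Subtype.ext (by simp only [coe_corePart, map_add, Submodule.coe_add]; abel)
  map_smul' t d := Subtype.ext (by
    simp only [coe_corePart, map_smul, Submodule.coe_smul, smul_sub, RingHom.id_apply])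

lemma corePart_eq_coreMap (d : 𝔸) : D.corePart d = D.coreMap d := rfl

@[simp] lemma coreMap_core (c : D.Core) : D.coreMap c = c :=
  Subtype.ext (by rw [← corePart_eq_coreMap, coe_corePart, proj_core, map_zero, sub_zero])

@[simp] lemma coreMap_zeroSection (v : V) : D.coreMap (D.zeroSection v) = 0 :=
  Subtype.ext (by
    rw [← corePart_eq_coreMap, coe_corePart, proj_zeroSection, sub_self, Submodule.coe_zero])

@[simp] lemma coreMap_coreSection (c : D.Core) (v : V) :
    D.coreMap (D.coreSection c v : 𝔸) = c := by
  rw [coe_coreSection, map_add, coreMap_core, coreMap_zeroSection, zero_add]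

@[simp] lemma coreMap_coe_add {v : V} (x y : D.Fibre v) :
    D.coreMap (x + y : D.Fibre v) = D.coreMap x + D.coreMap y := by
  rw [coe_add, map_sub, map_add, coreMap_zeroSection, sub_zero]

@[simp] lemma coreMap_coe_smul {v : V} (t : ℝ) (x : D.Fibre v) :
    D.coreMap (t • x : D.Fibre v) = t • D.coreMap x := by
  rw [coe_smul, map_add, map_smul, map_sub, coreMap_zeroSection, sub_zero, zero_add]

@[simp] lemma coreMap_coe_neg {v : V} (x : D.Fibre v) :
    D.coreMap (-x : D.Fibre v) = -D.coreMap x := by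
  rw [← neg_one_smul ℝ x, coreMap_coe_smul, neg_one_smul]

variable {D} in
lemma ext_proj_coreMap {d e : 𝔸} (h : D.proj d = D.proj e) (h' : D.coreMap d = D.coreMap e) :
    d = e := by
  rw [← D.zeroSection_add_corePart d, ← D.zeroSection_add_corePart e, h, corePart_eq_coreMap, h']
  rfl

variable {D} in
lemma fibre_ext {v : V} {x y : D.Fibre v} (h : D.coreMap x = D.coreMap y) : x = y :=
  Subtype.ext (ext_proj_coreMap (x.2.trans y.2.symm) h)

lemma mem_graphFibreAdd {z : 𝔸 × (𝔸 × 𝔸)} : z ∈ D.graphFibreAdd ↔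
    D.proj z.2.1 = D.proj z.1 ∧ D.proj z.2.2 = D.proj z.1 ∧
      D.coreMap z.1 = D.coreMap z.2.1 + D.coreMap z.2.2 := by
  constructor
  · rintro ⟨v, x, y, rfl⟩
    exact ⟨x.2.trans (x + y).2.symm, y.2.trans (x + y).2.symm, D.coreMap_coe_add x y⟩
  · rintro ⟨h1, h2, h3⟩
    obtain ⟨d, x, y⟩ := z
    refine ⟨D.proj d, ⟨x, h1⟩, ⟨y, h2⟩, Prod.ext (ext_proj_coreMap (D := D) ?_ ?_) rfl⟩
    · exact (⟨x, h1⟩ + ⟨y, h2⟩ : D.Fibre (D.proj d)).2.symm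
    · exact h3.trans (D.coreMap_coe_add ⟨x, h1⟩ ⟨y, h2⟩).symm

lemma isSmoothSection_iff {σ : ∀ v, D.Fibre v} :
    D.IsSmoothSection σ ↔ Smooth (fun v => D.coreMap (σ v)) := by
  constructor
  · exact fun h => Smooth.linear_comp (f := fun v => (σ v : 𝔸)) D.coreMap h
  · intro h
    refine (congrArg Smooth (funext fun v => ?_)).mp
      ((smooth_of_linear D.zeroSection).add (h.linear_comp D.Core.subtype))
    have hσ := D.zeroSection_add_corePart (σ v)
    rwa [(σ v).2] at hσ

/-- The section of `𝔸 → V` with a given core component. -/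
def sectionOfCore (s : V → D.Core) (v : V) : D.Fibre v := D.coreSection (s v) v

@[simp] lemma coreMap_sectionOfCore (s : V → D.Core) (v : V) :
    D.coreMap (D.sectionOfCore s v : 𝔸) = s v :=
  D.coreMap_coreSection (s v) v

lemma isSmoothSection_sectionOfCore {s : V → D.Core} (hs : Smooth s) :
    D.IsSmoothSection (D.sectionOfCore s) := by
  simpa only [isSmoothSection_iff, coreMap_sectionOfCore] using hs

lemma sectionOfCore_coreMap (σ : ∀ v, D.Fibre v) :
    D.sectionOfCore (fun v => D.coreMap (σ v)) = σ :=
  funext fun v => fibre_ext (D.coreMap_sectionOfCore _ v)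

/-- The annihilator of the graph of the addition of the vector space `𝔸`, parametrized by linear
coordinates. -/
def annihilatorGraphAddMap :
    (V × V × Module.Dual ℝ D.Core) →ₗ[ℝ] D.DualBundle × D.DualBundle × D.DualBundle where
  toFun p := ((p.1 + p.2.1, p.2.2), (p.1, -p.2.2), (p.2.1, -p.2.2))
  map_add' p q := by ext <;> simp <;> abel
  map_smul' t p := by ext <;> simp

lemma coe_range_annihilatorGraphAddMap :
    (LinearMap.range D.annihilatorGraphAddMap : Set (D.DualBundle × D.DualBundle × D.DualBundle)) =
      D.annihilatorGraphAdd := by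
  ext ⟨⟨v, ξ⟩, ⟨v₁, ξ₁⟩, ⟨v₂, ξ₂⟩⟩
  constructor
  · rintro ⟨⟨v₁, v₂, ξ⟩, ⟨⟩⟩
    refine ⟨rfl, fun d d' _ _ => ?_⟩
    simp only [corePart_eq_coreMap, map_add, LinearMap.neg_apply]
    ring
  · rintro ⟨hv, h⟩
    simp only at hv h
    simp only [corePart_eq_coreMap, map_add] at h
    refine ⟨(v₁, v₂, ξ), Prod.ext (Prod.ext hv.symm rfl) (Prod.ext (Prod.ext rfl ?_)
      (Prod.ext rfl ?_))⟩
    · ext c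
      have hc := h (D.coreSection c v₁) (D.zeroSection v₂) (D.coreSection c v₁).2 (by simp)
      simp only [coreMap_coreSection, coreMap_zeroSection, map_zero] at hc
      change -ξ c = ξ₁ c
      linarith
    · ext c
      have hc := h (D.zeroSection v₁) (D.coreSection c v₂) (by simp) (D.coreSection c v₂).2
      simp only [coreMap_coreSection, coreMap_zeroSection, map_zero] at hc
      change -ξ c = ξ₂ c
      linarith

lemma forall_annihilatorGraphAdd_covEval_eq_zero
    {p : D.DualCovector × D.DualCovector × D.DualCovector} :
    (∀ h ∈ LinearMap.range D.annihilatorGraphAddMap,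
      D.covEval p.1 h.1 + D.covEval p.2.1 h.2.1 + D.covEval p.2.2 h.2.2 = 0) ↔
    p.2.1.1 = -p.1.1 ∧ p.2.2.1 = -p.1.1 ∧ p.1.2 = p.2.1.2 + p.2.2.2 := by
  obtain ⟨⟨α, c⟩, ⟨α₁, c₁⟩, ⟨α₂, c₂⟩⟩ := p
  simp only [LinearMap.mem_range, forall_exists_index, forall_apply_eq_imp_iff]
  simp only [Prod.forall, annihilatorGraphAddMap, LinearMap.coe_mk, AddHom.coe_mk, covEval,
    LinearMap.neg_apply, map_add]
  constructor
  · intro h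
    refine ⟨?_, ?_, ?_⟩
    · ext v
      have hv := h v 0 0
      simp only [map_zero, LinearMap.zero_apply, neg_zero, add_zero] at hv
      rw [LinearMap.neg_apply]
      linarith
    · ext v
      have hv := h 0 v 0
      simp only [map_zero, LinearMap.zero_apply, neg_zero, add_zero, zero_add] at hv
      rw [LinearMap.neg_apply]
      linarith
    · refine eq_of_forall_dual_apply_eq fun ξ => ?_
      have hξ := h 0 0 ξ
      simp only [map_zero, zero_add] at hξ
      rw [map_add]
      linarith
  · rintro ⟨rfl, rfl, rfl⟩ v₁ v₂ ξ
    simp only [LinearMap.neg_apply, map_add]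
    ring

/-- The double vector subbundle over `W` with core `K`. -/
def subbundle (W : Submodule ℝ V) (K : Submodule ℝ D.Core) : Submodule ℝ 𝔸 :=
  W.comap D.proj ⊓ K.comap D.coreMap

variable {D} in
lemma mem_subbundle {W : Submodule ℝ V} {K : Submodule ℝ D.Core} {d : 𝔸} :
    d ∈ D.subbundle W K ↔ D.proj d ∈ W ∧ D.coreMap d ∈ K := Iff.rfl

lemma zeroSection_mem_subbundle {W : Submodule ℝ V} (K : Submodule ℝ D.Core) {v : V}
    (hv : v ∈ W) : D.zeroSection v ∈ D.subbundle W K :=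
  ⟨by simpa using hv, by simp⟩

lemma core_mem_subbundle (W : Submodule ℝ V) {K : Submodule ℝ D.Core} {c : D.Core}
    (hc : c ∈ K) : (c : 𝔸) ∈ D.subbundle W K :=
  ⟨by simp, by simpa using hc⟩

lemma isSubbundle_subbundle (W : Submodule ℝ V) (K : Submodule ℝ D.Core) :
    D.IsSubbundle (D.subbundle W K : Set 𝔸) where
  zero_mem := zero_mem _
  add_mem _ hx _ hy := add_mem hx hy
  smul_mem t _ hx := Submodule.smul_mem _ t hx
  fibre_add_mem v x y hx hy := by
    refine mem_subbundle.2 ⟨?_, ?_⟩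
    · rw [(x + y).2, ← x.2]
      exact hx.1
    · simpa only [coreMap_coe_add] using K.add_mem hx.2 hy.2
  fibre_smul_mem t v x hx := by
    refine mem_subbundle.2 ⟨?_, ?_⟩
    · rw [(t • x).2, ← x.2]
      exact hx.1
    · simpa only [coreMap_coe_smul] using K.smul_mem t hx.2

variable {D} in
lemma IsSubbundle.exists_eq_subbundle {L : Set 𝔸} (hL : D.IsSubbundle L) :
    ∃ W K, L = D.subbundle W K := by
  let S : Submodule ℝ 𝔸 :=
    { carrier := L
      zero_mem' := hL.zero_mem
      add_mem' := fun hx hy => hL.add_mem _ hx _ hy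
      smul_mem' := fun t _ hx => hL.smul_mem t _ hx }
  have zeroSection_mem {d : 𝔸} (hd : d ∈ S) : D.zeroSection (D.proj d) ∈ S := by
    have h := hL.fibre_smul_mem 0 (D.proj d) ⟨d, rfl⟩ hd
    rwa [zero_smul] at h
  refine ⟨S.map D.proj, S.comap D.Core.subtype, Set.ext fun d => ⟨fun hd => ?_, ?_⟩⟩
  · exact ⟨⟨d, hd, rfl⟩, S.sub_mem hd (zeroSection_mem hd)⟩
  · rintro ⟨⟨e, he, hed⟩, hd⟩
    rw [← D.zeroSection_add_corePart d, ← hed]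
    exact S.add_mem (zeroSection_mem he) hd

lemma annihilator_subbundle (W : Submodule ℝ V) (K : Submodule ℝ D.Core) :
    D.annihilator (D.subbundle W K : Set 𝔸) = W.prod K.dualAnnihilator := by
  ext ⟨v, ξ⟩
  constructor
  · rintro ⟨⟨d, hd, rfl⟩, h⟩
    refine ⟨hd.1, (Submodule.mem_dualAnnihilator _).2 fun c hc => ?_⟩
    have hsection := h (D.coreSection c (D.proj d)) (add_mem
      (D.zeroSection_mem_subbundle K hd.1) (D.core_mem_subbundle W hc)) (D.coreSection c _).2
    rwa [corePart_eq_coreMap, coreMap_coreSection] at hsection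
  · rintro ⟨hv, hξ⟩
    exact ⟨⟨D.zeroSection v, D.zeroSection_mem_subbundle K hv, D.proj_zeroSection v⟩,
      fun d hd _ => (Submodule.mem_dualAnnihilator _).1 hξ _ hd.2⟩

end DoubleVB

namespace Data

variable {V : Type*} {𝔸 : Type*} [AddCommGroup V] [Module ℝ V] [FiniteDimensional ℝ V]
  [AddCommGroup 𝔸] [Module ℝ 𝔸] [FiniteDimensional ℝ 𝔸] {A : Data V 𝔸}

/-- `𝔸 → V` is the action Lie algebroid of the core, regarded as an abelian Lie algebra acting on
`V` by the constant vector fields `a c`. -/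
structure IsActionAlgebroid (A : Data V 𝔸) (a : A.Core →ₗ[ℝ] V) : Prop where
  anchor_eq : ∀ d, A.anchor d = a (A.coreMap d)
  coreMap_bracket : ∀ σ τ, A.IsSmoothSection σ → A.IsSmoothSection τ → ∀ v,
    A.coreMap (A.bracket σ τ v : 𝔸) =
      actionBracket a (fun x => A.coreMap (σ x : 𝔸)) (fun x => A.coreMap (τ x : 𝔸)) v

lemma isSmoothSection_coreSection (c : A.Core) : A.IsSmoothSection (A.coreSection c) :=
  A.isSmoothSection_sectionOfCore (smooth_const c)

lemma coreSection_zero : A.coreSection (0 : A.Core) = 0 :=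
  funext fun v => DoubleVB.fibre_ext (by
    rw [A.coreMap_coreSection, Pi.zero_apply, A.coe_zero, A.coreMap_zeroSection])

lemma isCoisotropic_annihilatorGraphAdd_iff :
    IsCoisotropic
      (fun (p : A.DualCovector × A.DualCovector × A.DualCovector) h =>
        A.covEval p.1 h.1 + A.covEval p.2.1 h.2.1 + A.covEval p.2.2 h.2.2)
      (fun q p p' => A.poisson q.1 p.1 p'.1 + A.poisson q.2.1 p.2.1 p'.2.1
        + A.poisson q.2.2 p.2.2 p'.2.2)
      A.annihilatorGraphAdd ↔
    ∀ (v₁ v₂ : V) (ξ : Module.Dual ℝ A.Core) (α α' : Module.Dual ℝ V) (c₁ c₂ c₁' c₂' : A.Core),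
      A.poisson (v₁ + v₂, ξ) (α, c₁ + c₂) (α', c₁' + c₂')
        + A.poisson (v₁, -ξ) (-α, c₁) (-α', c₁') + A.poisson (v₂, -ξ) (-α, c₂) (-α', c₂') = 0 := by
  rw [← A.coe_range_annihilatorGraphAddMap, isCoisotropic_submodule]
  simp only [A.forall_annihilatorGraphAdd_covEval_eq_zero]
  constructor
  · intro h v₁ v₂ ξ α α' c₁ c₂ c₁' c₂'
    exact h _ ⟨(v₁, v₂, ξ), rfl⟩ ((α, c₁ + c₂), (-α, c₁), (-α, c₂))
      ((α', c₁' + c₂'), (-α', c₁'), (-α', c₂')) ⟨rfl, rfl, rfl⟩ ⟨rfl, rfl, rfl⟩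
  · rintro h _ ⟨⟨v₁, v₂, ξ⟩, rfl⟩ ⟨⟨α, c⟩, ⟨α₁, c₁⟩, ⟨α₂, c₂⟩⟩ ⟨⟨α', c'⟩, ⟨α₁', c₁'⟩, ⟨α₂', c₂'⟩⟩
      ⟨h₁, h₂, hc⟩ ⟨h₁', h₂', hc'⟩
    simp only at h₁ h₂ hc h₁' h₂' hc'
    subst h₁ h₂ hc h₁' h₂' hc'
    exact h v₁ v₂ ξ α α' c₁ c₂ c₁' c₂'

section LieAlgebroid

lemma IsLieAlgebroid.anchor_zeroSection (h : A.IsLieAlgebroid) (v : V) :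
    A.anchor (A.zeroSection v) = 0 := by
  have hsmul := h.anchor_smul 0 v 0
  rwa [zero_smul, zero_smul] at hsmul

lemma IsLieAlgebroid.bracket_zero (h : A.IsLieAlgebroid) {σ : ∀ v, A.Fibre v}
    (hσ : A.IsSmoothSection σ) : A.bracket σ 0 = 0 := by
  have hsmul := h.bracket_smul 0 σ σ hσ hσ
  rwa [zero_smul, zero_smul] at hsmul

lemma IsLieAlgebroid.isDerivationAlong_coreMap_bracket (h : A.IsLieAlgebroid) {s : V → A.Core}
    (hs : Smooth s) : IsDerivationAlong (fun v => A.anchor (A.sectionOfCore s v))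
      (fun t v => A.coreMap (A.bracket (A.sectionOfCore s) (A.sectionOfCore t) v : 𝔸)) where
  map_add t t' ht ht' v := by
    have hadd : (A.sectionOfCore fun x => t x + t' x) = A.sectionOfCore t + A.sectionOfCore t' :=
      funext fun x => DoubleVB.fibre_ext (by simp)
    rw [hadd, h.bracket_add _ _ _ (A.isSmoothSection_sectionOfCore hs)
      (A.isSmoothSection_sectionOfCore ht) (A.isSmoothSection_sectionOfCore ht'), Pi.add_apply,
      A.coreMap_coe_add]
  leibniz f t hf ht v := by
    have hsmul : (A.sectionOfCore fun x => f x • t x) = fun x => f x • A.sectionOfCore t x :=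
      funext fun x => DoubleVB.fibre_ext (by simp)
    rw [hsmul, h.leibniz _ _ _ (A.isSmoothSection_sectionOfCore hs)
      (A.isSmoothSection_sectionOfCore ht) hf, A.coreMap_coe_add, A.coreMap_coe_smul,
      A.coreMap_coe_smul, A.coreMap_sectionOfCore, lineDeriv_eq_dirDeriv hf]

lemma IsLAVectorBundle.anchor_add (h : A.IsLAVectorBundle) (d e : 𝔸) :
    A.anchor (d + e) = A.anchor d + A.anchor e := by
  have coreSection_coreMap (x : 𝔸) : (A.coreSection (A.coreMap x) (A.proj x) : 𝔸) = x :=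
    A.zeroSection_add_corePart x
  refine eq_of_forall_dual_apply_eq fun α => ?_
  have hpoisson := isCoisotropic_annihilatorGraphAdd_iff.1 h.graph_add (A.proj d) (A.proj e) 0 0 α
    (A.coreMap d) (A.coreMap e) 0 0
  rw [← map_add A.proj, ← map_add A.coreMap] at hpoisson
  simp only [poisson, LinearMap.zero_apply, LinearMap.neg_apply, neg_zero,
    coreSection_coreMap] at hpoisson
  rw [map_add]
  linarith

lemma IsLAVectorBundle.bracket_coreSection (h : A.IsLAVectorBundle) (c c' : A.Core) (v : V) :
    A.coreMap (A.bracket (A.coreSection c) (A.coreSection c') v : 𝔸) = 0 := by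
  refine (Module.forall_dual_apply_eq_zero_iff ℝ _).1 fun ξ => ?_
  have hpoisson :=
    isCoisotropic_annihilatorGraphAdd_iff.1 h.graph_add v 0 ξ 0 0 c 0 0 c'
  have hright : A.bracket (A.coreSection c) (A.coreSection 0) = 0 := by
    rw [coreSection_zero, h.lieAlgebroid.bracket_zero (isSmoothSection_coreSection c)]
  have hleft : A.bracket (A.coreSection 0) (A.coreSection c') = 0 := by
    rw [h.lieAlgebroid.bracket_skew _ _ (isSmoothSection_coreSection 0)
      (isSmoothSection_coreSection c'), coreSection_zero,
      h.lieAlgebroid.bracket_zero (isSmoothSection_coreSection c'), neg_zero]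
  simp only [poisson, hleft, hright, LinearMap.zero_apply, neg_zero, zero_add, add_zero, sub_zero,
    A.corePart_eq_coreMap, Pi.zero_apply, A.coe_zero, A.coreMap_zeroSection, map_zero] at hpoisson
  rwa [add_zero] at hpoisson

lemma IsLAVectorBundle.exists_isActionAlgebroid (h : A.IsLAVectorBundle) :
    ∃ a, A.IsActionAlgebroid a := by
  have hL := h.lieAlgebroid
  let a : A.Core →ₗ[ℝ] V :=
    { toFun := fun c => A.anchor c
      map_add' := fun c c' => h.anchor_add c c'
      map_smul' := fun t c => by
        rw [RingHom.id_apply, ← hL.anchor_smul t 0 ⟨c, A.proj_core c⟩, A.coe_smul_zero]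
        rfl }
  have hanchor (d : 𝔸) : A.anchor d = a (A.coreMap d) := by
    conv_lhs => rw [← A.zeroSection_add_corePart d]
    rw [h.anchor_add, hL.anchor_zeroSection, zero_add]
    rfl
  refine ⟨a, hanchor, fun σ τ hσ hτ v => ?_⟩
  rw [← eq_actionBracket (a := a)
    (B := fun s t v => A.coreMap (A.bracket (A.sectionOfCore s) (A.sectionOfCore t) v : 𝔸))
    (fun s hs => ?_) (fun s t hs ht v => ?_) h.bracket_coreSection
    (A.isSmoothSection_iff.1 hσ) (A.isSmoothSection_iff.1 hτ), A.sectionOfCore_coreMap,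
    A.sectionOfCore_coreMap]
  · simpa only [hanchor, A.coreMap_sectionOfCore] using hL.isDerivationAlong_coreMap_bracket hs
  · rw [hL.bracket_skew _ _ (A.isSmoothSection_sectionOfCore hs)
      (A.isSmoothSection_sectionOfCore ht), Pi.neg_apply, A.coreMap_coe_neg]

end LieAlgebroid

namespace IsActionAlgebroid

variable {a : A.Core →ₗ[ℝ] V}

lemma isSmoothSection_bracket (h : A.IsActionAlgebroid a) {σ τ : ∀ v, A.Fibre v}
    (hσ : A.IsSmoothSection σ) (hτ : A.IsSmoothSection τ) :
    A.IsSmoothSection (A.bracket σ τ) := by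
  rw [A.isSmoothSection_iff, funext (h.coreMap_bracket σ τ hσ hτ)]
  exact (A.isSmoothSection_iff.1 hσ).actionBracket a (A.isSmoothSection_iff.1 hτ)

lemma bracket_leibniz (h : A.IsActionAlgebroid a) {σ τ : ∀ v, A.Fibre v} {f : V → ℝ}
    (hσ : A.IsSmoothSection σ) (hτ : A.IsSmoothSection τ) (hf : Smooth f) :
    A.bracket σ (fun v => f v • τ v) =
      fun v => lineDeriv ℝ f v (A.anchor (σ v)) • τ v + f v • A.bracket σ τ v := by
  have hτ' := A.isSmoothSection_iff.1 hτ
  have hfτ : A.IsSmoothSection (fun v => f v • τ v) := by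
    simpa only [A.isSmoothSection_iff, A.coreMap_coe_smul] using hf.smul hτ'
  refine funext fun v => DoubleVB.fibre_ext ?_
  rw [h.coreMap_bracket _ _ hσ hfτ]
  simp only [A.coreMap_coe_add, A.coreMap_coe_smul]
  rw [h.coreMap_bracket _ _ hσ hτ, lineDeriv_eq_dirDeriv hf, h.anchor_eq]
  exact (isDerivationAlong_actionBracket a (A.isSmoothSection_iff.1 hσ)).leibniz f _ hf hτ' v

lemma bracket_jacobi (h : A.IsActionAlgebroid a) {σ τ υ : ∀ v, A.Fibre v}
    (hσ : A.IsSmoothSection σ) (hτ : A.IsSmoothSection τ) (hυ : A.IsSmoothSection υ) :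
    A.bracket σ (A.bracket τ υ) = A.bracket (A.bracket σ τ) υ + A.bracket τ (A.bracket σ υ) := by
  refine funext fun v => DoubleVB.fibre_ext ?_
  rw [Pi.add_apply, A.coreMap_coe_add, h.coreMap_bracket _ _ hσ (h.isSmoothSection_bracket hτ hυ),
    h.coreMap_bracket _ _ (h.isSmoothSection_bracket hσ hτ) hυ,
    h.coreMap_bracket _ _ hτ (h.isSmoothSection_bracket hσ hυ),
    funext (h.coreMap_bracket _ _ hτ hυ), funext (h.coreMap_bracket _ _ hσ hτ),
    funext (h.coreMap_bracket _ _ hσ hυ)]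
  exact actionBracket_jacobi a (A.isSmoothSection_iff.1 hσ) (A.isSmoothSection_iff.1 hτ)
    (A.isSmoothSection_iff.1 hυ) v

lemma isLieAlgebroid (h : A.IsActionAlgebroid a) : A.IsLieAlgebroid where
  anchor_smooth := by
    rw [funext h.anchor_eq]
    exact smooth_of_linear (a ∘ₗ A.coreMap)
  anchor_add v x y := by simp only [h.anchor_eq, A.coreMap_coe_add, map_add]
  anchor_smul t v x := by simp only [h.anchor_eq, A.coreMap_coe_smul, map_smul]
  bracket_smooth σ τ hσ hτ := h.isSmoothSection_bracket hσ hτ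
  bracket_add σ τ υ hσ hτ hυ := by
    have hτ' := A.isSmoothSection_iff.1 hτ
    have hυ' := A.isSmoothSection_iff.1 hυ
    have hτυ : A.IsSmoothSection (τ + υ) := by
      simpa only [A.isSmoothSection_iff, Pi.add_apply, A.coreMap_coe_add] using hτ'.add hυ'
    refine funext fun v => DoubleVB.fibre_ext ?_
    rw [Pi.add_apply, A.coreMap_coe_add, h.coreMap_bracket _ _ hσ hτυ,
      h.coreMap_bracket _ _ hσ hτ, h.coreMap_bracket _ _ hσ hυ]
    simp only [Pi.add_apply, A.coreMap_coe_add]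
    exact (isDerivationAlong_actionBracket a (A.isSmoothSection_iff.1 hσ)).map_add _ _ hτ' hυ' v
  bracket_smul t σ τ hσ hτ := by
    refine (h.bracket_leibniz hσ hτ (smooth_const t)).trans (funext fun v => ?_)
    rw [lineDeriv_eq_dirDeriv (smooth_const t), dirDeriv_const, zero_smul, zero_add]
    rfl
  bracket_skew σ τ hσ hτ := funext fun v => DoubleVB.fibre_ext (by
    rw [Pi.neg_apply, A.coreMap_coe_neg, h.coreMap_bracket _ _ hσ hτ, h.coreMap_bracket _ _ hτ hσ,
      actionBracket_skew])
  jacobi σ τ υ hσ hτ hυ := h.bracket_jacobi hσ hτ hυ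
  leibniz σ τ f hσ hτ hf := h.bracket_leibniz hσ hτ hf

lemma poisson_eq (h : A.IsActionAlgebroid a) (q : A.DualBundle) (p p' : A.DualCovector) :
    A.poisson q p p' = p'.1 (a p.2) - p.1 (a p'.2) := by
  have hcore : A.coreMap (A.bracket (A.coreSection p.2) (A.coreSection p'.2) q.1 : 𝔸) = 0 := by
    rw [h.coreMap_bracket _ _ (isSmoothSection_coreSection _) (isSmoothSection_coreSection _)]
    simp only [A.coreMap_coreSection, actionBracket_const]
  simp only [poisson, h.anchor_eq, A.corePart_eq_coreMap, hcore, A.coreMap_coreSection, map_zero,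
    zero_add]

lemma isLAVectorBundle (h : A.IsActionAlgebroid a) : A.IsLAVectorBundle where
  lieAlgebroid := h.isLieAlgebroid
  graph_add := isCoisotropic_annihilatorGraphAdd_iff.2 fun v₁ v₂ ξ α α' c₁ c₂ c₁' c₂' => by
    simp only [h.poisson_eq, map_add, LinearMap.neg_apply]
    ring

end IsActionAlgebroid

theorem isLAVectorBundle_iff_exists_isActionAlgebroid :
    A.IsLAVectorBundle ↔ ∃ a, A.IsActionAlgebroid a :=
  ⟨IsLAVectorBundle.exists_isActionAlgebroid, fun ⟨_, h⟩ => h.isLAVectorBundle⟩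

namespace IsActionAlgebroid

variable {a : A.Core →ₗ[ℝ] V}

lemma mem_graphSharp_iff (h : A.IsActionAlgebroid a)
    {z : (A.DualBundle × A.DualBundle) × (A.DualBundle × A.DualCovector)} :
    z ∈ A.graphSharp ↔ z.1.1 = z.2.1 ∧ z.1.2 = (a z.2.2.2, -(z.2.2.1 ∘ₗ a)) := by
  obtain ⟨⟨q', w, η⟩, q, α, c⟩ := z
  simp only [graphSharp, Set.mem_ofPred_eq, h.poisson_eq, DoubleVB.covEval]
  refine and_congr_right fun _ => ⟨fun H => Prod.ext ?_ ?_, fun H p' => ?_⟩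
  · exact eq_of_forall_dual_apply_eq fun α' => by simpa using H (α', 0)
  · ext e
    simpa using H (0, e)
  · obtain ⟨rfl, rfl⟩ := Prod.mk.inj H
    exact (sub_eq_add_neg _ _).symm

lemma mem_graphSharp_and_composable_iff (h : A.IsActionAlgebroid a) {Y X : 𝔸 × 𝔸}
    {z : (A.DualBundle × A.DualBundle) × (A.DualBundle × A.DualCovector)} :
    z ∈ A.graphSharp ∧ A.Composable Y X z ↔
      (A.proj Y.1 = A.proj X.1 ∧ A.proj Y.2 = a (A.coreMap X.1)) ∧ ∃ ξ α,
        z = (((A.proj X.1, ξ), (a (A.coreMap X.1), -(α ∘ₗ a))),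
          ((A.proj X.1, ξ), (α, A.coreMap X.1))) := by
  rw [h.mem_graphSharp_iff]
  constructor
  · obtain ⟨⟨q', η⟩, ⟨v, ξ⟩, α, c⟩ := z
    obtain ⟨x, x'⟩ := X
    rintro ⟨⟨hq, hη⟩, ⟨hproj, hproj'⟩, hx⟩
    simp only at hq hη hx
    subst hq hη hx
    simp only [A.coreMap_coreSection, (A.coreSection c v).2]
    exact ⟨⟨hproj.symm, hproj'.symm⟩, ξ, α, rfl⟩
  · rintro ⟨⟨hproj, hproj'⟩, ξ, α, rfl⟩
    exact ⟨⟨rfl, rfl⟩, ⟨hproj.symm, hproj'.symm⟩, A.zeroSection_add_corePart X.1⟩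

lemma mem_poissonRelation_iff_forall_dual (h : A.IsActionAlgebroid a)
    {w : (𝔸 × 𝔸) × (𝔸 × 𝔸)} : w ∈ A.poissonRelation ↔
      (A.proj w.1.1 = A.proj w.2.1 ∧ A.proj w.1.2 = a (A.coreMap w.2.1)) ∧
      ∀ (ξ : Module.Dual ℝ A.Core) (α : Module.Dual ℝ V),
        -α (a (A.coreMap w.1.1)) + ξ (A.coreMap w.1.2) =
          ξ (A.coreMap w.2.2) - α (A.proj w.2.2) := by
  simp only [poissonRelation, Set.mem_ofPred_eq, h.mem_graphSharp_and_composable_iff, ← and_imp]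
  constructor
  · rintro ⟨⟨z, hproj, -⟩, H⟩
    refine ⟨hproj, fun ξ α => ?_⟩
    have hpair := H _ ⟨hproj, ξ, α, rfl⟩
    simp only [DoubleVB.tangentPairing, DoubleVB.cotangentPairing, DoubleVB.covEval,
      A.corePart_eq_coreMap, LinearMap.neg_apply, LinearMap.comp_apply,
      LinearMap.zero_apply] at hpair
    linarith
  · rintro ⟨hproj, H⟩
    refine ⟨⟨_, hproj, 0, 0, rfl⟩, ?_⟩
    rintro z ⟨-, ξ, α, rfl⟩
    simp only [DoubleVB.tangentPairing, DoubleVB.cotangentPairing, DoubleVB.covEval,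
      A.corePart_eq_coreMap, LinearMap.neg_apply, LinearMap.comp_apply, LinearMap.zero_apply]
    linarith [H ξ α]

lemma mem_poissonRelation_iff (h : A.IsActionAlgebroid a) {w : (𝔸 × 𝔸) × (𝔸 × 𝔸)} :
    w ∈ A.poissonRelation ↔
      (A.proj w.1.1 = A.proj w.2.1 ∧ A.proj w.1.2 = a (A.coreMap w.2.1)) ∧
        A.proj w.2.2 = a (A.coreMap w.1.1) ∧ A.coreMap w.1.2 = A.coreMap w.2.2 := by
  rw [h.mem_poissonRelation_iff_forall_dual]
  refine and_congr_right fun _ => ⟨fun H => ⟨?_, ?_⟩, ?_⟩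
  · exact eq_of_forall_dual_apply_eq fun α => by simpa using (H 0 α).symm
  · exact eq_of_forall_dual_apply_eq fun ξ => by simpa using H ξ 0
  · rintro ⟨hproj, hcore⟩ ξ α
    rw [hproj, hcore]
    ring

lemma isLieSubalgebroid_subbundle_iff (h : A.IsActionAlgebroid a) {W : Submodule ℝ V}
    {K : Submodule ℝ A.Core} :
    A.IsLieSubalgebroid (A.subbundle W K : Set 𝔸) ↔ K.map a ≤ W := by
  have conormal (p : A.DualCovector) :
      (∀ h ∈ W.prod K.dualAnnihilator, A.covEval p h = 0) ↔ p.1 ∈ W.dualAnnihilator ∧ p.2 ∈ K := by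
    rw [Submodule.mem_dualAnnihilator, ← Subspace.forall_mem_dualAnnihilator_apply_eq_zero_iff K]
    refine ⟨fun H => ⟨fun v hv => ?_, fun ξ hξ => ?_⟩, fun H q hq => ?_⟩
    · simpa [DoubleVB.covEval] using H (v, 0) ⟨hv, zero_mem _⟩
    · simpa [DoubleVB.covEval] using H (0, ξ) ⟨zero_mem _, hξ⟩
    · rw [DoubleVB.covEval, H.1 _ hq.1, H.2 _ hq.2, add_zero]
  rw [IsLieSubalgebroid, A.annihilator_subbundle, isCoisotropic_submodule,
    Submodule.map_le_iff_le_comap]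
  simp only [conormal, h.poisson_eq]
  constructor
  · intro H c hc
    rw [Submodule.mem_comap, ← Subspace.forall_mem_dualAnnihilator_apply_eq_zero_iff]
    intro α hα
    simpa using H 0 (zero_mem _) (0, c) (α, 0) ⟨zero_mem _, hc⟩ ⟨hα, zero_mem _⟩
  · rintro H - - p p' ⟨hα, hc⟩ ⟨hα', hc'⟩
    rw [(Submodule.mem_dualAnnihilator _).1 hα' _ (H hc),
      (Submodule.mem_dualAnnihilator _).1 hα _ (H hc'), sub_zero]

end IsActionAlgebroid

section Iso

variable {V' : Type*} {𝔸' : Type*} [AddCommGroup V'] [Module ℝ V'] [FiniteDimensional ℝ V']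
  [AddCommGroup 𝔸'] [Module ℝ 𝔸'] [FiniteDimensional ℝ 𝔸'] {A' : Data V' 𝔸'}
  {Φ : 𝔸 ≃ₗ[ℝ] 𝔸'} {φ : V ≃ₗ[ℝ] V'}

lemma IsIso.map_zeroSection (h : A.IsIso A' Φ φ) (v : V) :
    Φ (A.zeroSection v) = A'.zeroSection (φ v) := by
  have hproj : A'.proj (Φ (A.zeroSection v)) = φ v := by rw [h.map_proj, A.proj_zeroSection]
  have hsmul := h.map_fibre_smul 0 v 0 ⟨_, hproj⟩ rfl
  rwa [zero_smul, zero_smul] at hsmul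

lemma exists_core_map (hproj : ∀ d, A'.proj (Φ d) = φ (A.proj d))
    (hzero : ∀ v, Φ (A.zeroSection v) = A'.zeroSection (φ v)) :
    ∃ l : A.Core →ₗ[ℝ] A'.Core, ∀ d, A'.coreMap (Φ d) = l (A.coreMap d) := by
  refine ⟨Φ.toLinearMap.restrict fun c hc => ?_, fun d => Subtype.ext ?_⟩
  · rw [LinearMap.mem_ker] at hc ⊢
    rw [LinearEquiv.coe_coe, hproj, hc, map_zero]
  · change Φ d - A'.zeroSection (A'.proj (Φ d)) = Φ (d - A.zeroSection (A.proj d))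
    rw [hproj, map_sub, hzero]

/-- The compatibility with the bracket of sections follows from that with the anchor, since the
bracket of an action Lie algebroid of an abelian Lie algebra is natural. -/
theorem IsActionAlgebroid.isIso_iff {a : A.Core →ₗ[ℝ] V} {a' : A'.Core →ₗ[ℝ] V'}
    (h : A.IsActionAlgebroid a) (h' : A'.IsActionAlgebroid a') :
    A.IsIso A' Φ φ ↔ (∀ d, A'.proj (Φ d) = φ (A.proj d)) ∧
      (∀ v, Φ (A.zeroSection v) = A'.zeroSection (φ v)) ∧
      A.courant.IsIso A'.courant Φ ∧ ∀ d, A'.anchor (Φ d) = φ (A.anchor d) := by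
  refine ⟨fun H => ⟨H.map_proj, H.map_zeroSection, ⟨H.map_metric, H.map_courant⟩, H.map_anchor⟩, ?_⟩
  rintro ⟨hproj, hzero, ⟨hmetric, hcourant⟩, hanchor⟩
  obtain ⟨l, hcore⟩ := exists_core_map hproj hzero
  refine ⟨hproj, fun v x y x' y' hx hy => ?_, fun t v x x' hx => ?_, hmetric, hcourant, hanchor, ?_⟩
  · rw [A.coe_add, A'.coe_add, map_sub, map_add, hx, hy, hzero]
  · rw [A.coe_smul, A'.coe_smul, map_add, map_smul, map_sub, hx, hzero]
  · intro σ τ σ' τ' hσ hτ hσ' hτ' hσσ' hττ' v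
    refine A'.ext_proj_coreMap ?_ ?_
    · rw [hproj, (A.bracket σ τ v).2, (A'.bracket σ' τ' (φ v)).2]
    rw [hcore, h.coreMap_bracket _ _ hσ hτ, h'.coreMap_bracket _ _ hσ' hτ']
    refine map_actionBracket (m := φ.toLinearMap) (fun c => ?_) (A.isSmoothSection_iff.1 hσ)
      (A.isSmoothSection_iff.1 hτ) (A'.isSmoothSection_iff.1 hσ') (A'.isSmoothSection_iff.1 hτ')
      (fun x => ?_) (fun x => ?_) v
    · have hc := hanchor c
      rw [h.anchor_eq, h'.anchor_eq, hcore, A.coreMap_core] at hc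
      exact hc.symm
    · rw [← hcore, hσσ']
      rfl
    · rw [← hcore, hττ']
      rfl

end Iso

end Data

namespace DoubleVB

variable {V 𝔸 C : Type*} [AddCommGroup V] [Module ℝ V] [FiniteDimensional ℝ V]
  [AddCommGroup 𝔸] [Module ℝ 𝔸] [FiniteDimensional ℝ 𝔸] [AddCommGroup C] [Module ℝ C]

/-- The splitting of `𝔸` as the direct sum of its side bundle and of its core, the latter being
identified with `C` by means of `θ`. -/
def splitting (D : DoubleVB V 𝔸) (θ : D.Core ≃ₗ[ℝ] C) : 𝔸 ≃ₗ[ℝ] V × C where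
  toLinearMap := D.proj.prod (θ.toLinearMap ∘ₗ D.coreMap)
  invFun p := D.zeroSection p.1 + θ.symm p.2
  left_inv d := by
    change D.zeroSection (D.proj d) + (θ.symm (θ (D.coreMap d)) : 𝔸) = d
    rw [θ.symm_apply_apply]
    exact D.zeroSection_add_corePart d
  right_inv p := by simp

lemma splitting_apply (D : DoubleVB V 𝔸) (θ : D.Core ≃ₗ[ℝ] C) (d : 𝔸) :
    D.splitting θ d = (D.proj d, θ (D.coreMap d)) := rfl

lemma splitting_zeroSection (D : DoubleVB V 𝔸) (θ : D.Core ≃ₗ[ℝ] C) (v : V) :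
    D.splitting θ (D.zeroSection v) = (v, 0) := by
  rw [splitting_apply, proj_zeroSection, coreMap_zeroSection, map_zero]

end DoubleVB

namespace Data

section VBCourant

variable {V 𝔸 : Type*} [AddCommGroup V] [Module ℝ V] [FiniteDimensional ℝ V]
  [AddCommGroup 𝔸] [Module ℝ 𝔸] [FiniteDimensional ℝ 𝔸] {A : Data V 𝔸}

lemma zeroSection_mem_graphFibreAdd (x : V) :
    (A.zeroSection x, A.zeroSection x, A.zeroSection x) ∈ A.graphFibreAdd := by
  simp [DoubleVB.mem_graphFibreAdd]

lemma core_left_mem_graphFibreAdd (c : A.Core) :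
    ((c : 𝔸), (c : 𝔸), (0 : 𝔸)) ∈ A.graphFibreAdd := by
  simp [DoubleVB.mem_graphFibreAdd]

lemma core_right_mem_graphFibreAdd (c : A.Core) :
    ((c : 𝔸), (0 : 𝔸), (c : 𝔸)) ∈ A.graphFibreAdd := by
  simp [DoubleVB.mem_graphFibreAdd]

/-- The pairing of the core with the side bundle which is induced by the metric. -/
def corePairing (A : Data V 𝔸) : A.Core →ₗ[ℝ] Module.Dual ℝ V :=
  A.courant.metric.compl₁₂ A.Core.subtype A.zeroSection

lemma corePairing_apply (c : A.Core) (x : V) :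
    A.corePairing c x = A.courant.metric c (A.zeroSection x) := rfl

namespace IsVBCourant

lemma metric_of_mem_graphFibreAdd (h : A.IsVBCourant) {z z' : 𝔸 × 𝔸 × 𝔸}
    (hz : z ∈ A.graphFibreAdd) (hz' : z' ∈ A.graphFibreAdd) :
    A.courant.metric z.1 z'.1 =
      A.courant.metric z.2.1 z'.2.1 + A.courant.metric z.2.2 z'.2.2 := by
  have hmetric := (h.graph_add.lagrangian z).1 hz z' hz'
  rwa [MetricBracket.prod_bar_metric, MetricBracket.prod_metric, sub_eq_zero] at hmetric

lemma bracket_mem_graphFibreAdd (h : A.IsVBCourant) {z z' : 𝔸 × 𝔸 × 𝔸}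
    (hz : z ∈ A.graphFibreAdd) (hz' : z' ∈ A.graphFibreAdd) :
    (A.courant.bracket z.1 z'.1, A.courant.bracket z.2.1 z'.2.1,
      A.courant.bracket z.2.2 z'.2.2) ∈ A.graphFibreAdd :=
  h.graph_add.involutive z hz z' hz'

lemma metric_zeroSection (h : A.IsVBCourant) (x y : V) :
    A.courant.metric (A.zeroSection x) (A.zeroSection y) = 0 :=
  left_eq_add.1 (h.metric_of_mem_graphFibreAdd (zeroSection_mem_graphFibreAdd x)
    (zeroSection_mem_graphFibreAdd y))

lemma metric_core (h : A.IsVBCourant) (c c' : A.Core) : A.courant.metric c c' = 0 := by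
  simpa using h.metric_of_mem_graphFibreAdd (core_left_mem_graphFibreAdd c)
    (core_right_mem_graphFibreAdd c')

lemma coreMap_bracket_zeroSection (h : A.IsVBCourant) (x y : V) :
    A.coreMap (A.courant.bracket (A.zeroSection x) (A.zeroSection y)) = 0 :=
  left_eq_add.1 (A.mem_graphFibreAdd.1 (h.bracket_mem_graphFibreAdd
    (zeroSection_mem_graphFibreAdd x) (zeroSection_mem_graphFibreAdd y))).2.2

lemma zeroSection_proj_bracket (h : A.IsVBCourant) (x y : V) :
    A.zeroSection (A.proj (A.courant.bracket (A.zeroSection x) (A.zeroSection y))) =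
      A.courant.bracket (A.zeroSection x) (A.zeroSection y) :=
  A.ext_proj_coreMap (A.proj_zeroSection _) (by
    rw [A.coreMap_zeroSection, h.coreMap_bracket_zeroSection])

lemma proj_bracket_core (h : A.IsVBCourant) (x : V) (c : A.Core) :
    A.proj (A.courant.bracket (A.zeroSection x) c) = 0 := by
  have hmem := A.mem_graphFibreAdd.1 (h.bracket_mem_graphFibreAdd (zeroSection_mem_graphFibreAdd x)
    (core_left_mem_graphFibreAdd c))
  simpa using hmem.2.1.symm

lemma bracket_core_core (h : A.IsVBCourant) (c c' : A.Core) :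
    A.courant.bracket (c : 𝔸) c' = 0 := by
  have hmem := A.mem_graphFibreAdd.1 (h.bracket_mem_graphFibreAdd (core_left_mem_graphFibreAdd c)
    (core_right_mem_graphFibreAdd c'))
  simp only [map_zero, LinearMap.zero_apply, add_zero] at hmem
  exact A.ext_proj_coreMap (by rw [map_zero, ← hmem.1]) (by rw [map_zero, hmem.2.2])

/-- The Lie bracket on the side bundle of a VB-Courant algebroid over a point, for which the zero
section is a homomorphism. -/
abbrev lieRing (h : A.IsVBCourant) : LieRing V :=
  { (inferInstance : AddCommGroup V) with
    bracket x y := A.proj (A.courant.bracket (A.zeroSection x) (A.zeroSection y))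
    add_lie x y z := by
      change A.proj _ = A.proj _ + A.proj _
      rw [map_add, map_add, LinearMap.add_apply, map_add]
    lie_add x y z := by
      change A.proj _ = A.proj _ + A.proj _
      rw [map_add, map_add, map_add]
    lie_self x := by
      change A.proj _ = 0
      have hskew := h.courantAlgebroid.bracket_add_swap (A.zeroSection x) (A.zeroSection x)
      rw [← two_smul ℝ, smul_eq_zero] at hskew
      rw [hskew.resolve_left two_ne_zero, map_zero]
    leibniz_lie x y z := by
      change A.proj (A.courant.bracket _ (A.zeroSection (A.proj _))) =
        A.proj (A.courant.bracket (A.zeroSection (A.proj _)) _) +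
        A.proj (A.courant.bracket _ (A.zeroSection (A.proj _)))
      simp only [h.zeroSection_proj_bracket]
      rw [h.courantAlgebroid.jacobi, map_add] }

/-- The Lie bracket on the side bundle is bilinear over `ℝ`. -/
abbrev lieAlgebra (h : A.IsVBCourant) : @LieAlgebra ℝ V _ h.lieRing :=
  letI := h.lieRing
  { (inferInstance : Module ℝ V) with
    lie_smul t x y := by
      change A.proj (A.courant.bracket (A.zeroSection x) (A.zeroSection (t • y))) = t • A.proj _
      rw [map_smul, map_smul, map_smul] }

lemma metric_eq (h : A.IsVBCourant) (d e : 𝔸) : A.courant.metric d e =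
    A.corePairing (A.coreMap d) (A.proj e) + A.corePairing (A.coreMap e) (A.proj d) := by
  conv_lhs => rw [← A.zeroSection_add_corePart d, ← A.zeroSection_add_corePart e]
  rw [map_add, map_add, LinearMap.add_apply, LinearMap.add_apply, h.metric_zeroSection,
    h.metric_core, h.courantAlgebroid.metric_symm (A.zeroSection _), zero_add, add_zero]
  rfl

lemma corePairing_isPerfPair (h : A.IsVBCourant) : A.corePairing.IsPerfPair := by
  refine .of_injective ((injective_iff_map_eq_zero _).2 fun c hc => ?_)
    ((injective_iff_map_eq_zero _).2 fun x hx => ?_)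
  · refine Subtype.ext (h.courantAlgebroid.metric_nondegenerate _ fun e => ?_)
    rw [h.metric_eq, A.coreMap_core, hc, A.proj_core, LinearMap.zero_apply, map_zero, add_zero]
  · rw [← A.proj_zeroSection x,
      h.courantAlgebroid.metric_nondegenerate (A.zeroSection x) fun e => ?_, map_zero]
    rw [h.metric_eq, A.coreMap_zeroSection, A.proj_zeroSection, map_zero, LinearMap.zero_apply,
      zero_add]
    exact LinearMap.congr_fun hx (A.coreMap e)

lemma bracket_eq (h : A.IsVBCourant) (d e : 𝔸) : A.courant.bracket d e =
    A.courant.bracket (A.zeroSection (A.proj d)) (A.zeroSection (A.proj e)) +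
      (A.courant.bracket (A.zeroSection (A.proj d)) (A.coreMap e) -
        A.courant.bracket (A.zeroSection (A.proj e)) (A.coreMap d)) := by
  conv_lhs => rw [← A.zeroSection_add_corePart d, ← A.zeroSection_add_corePart e]
  rw [map_add, map_add, LinearMap.add_apply, LinearMap.add_apply, h.bracket_core_core,
    eq_neg_of_add_eq_zero_left
      (h.courantAlgebroid.bracket_add_swap (A.corePart d : 𝔸) (A.zeroSection (A.proj e))),
    add_zero]
  simp only [A.corePart_eq_coreMap]
  abel

end IsVBCourant

end VBCourant

section Semidirect

variable {V 𝔸 : Type*} [LieRing V] [LieAlgebra ℝ V] [FiniteDimensional ℝ V]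
  [AddCommGroup 𝔸] [Module ℝ 𝔸] [FiniteDimensional ℝ 𝔸] {A : Data V 𝔸}

namespace IsVBCourant

lemma corePairing_bracket (h : A.IsVBCourant)
    (hlie : ∀ x y : V, ⁅x, y⁆ = A.proj (A.courant.bracket (A.zeroSection x) (A.zeroSection y)))
    (x : V) (c : A.Core) :
    A.corePairing (A.coreMap (A.courant.bracket (A.zeroSection x) c)) = ⁅x, A.corePairing c⁆ := by
  ext y
  have hcore : (A.coreMap (A.courant.bracket (A.zeroSection x) c) : 𝔸) =
      A.courant.bracket (A.zeroSection x) c :=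
    A.ext_proj_coreMap (by rw [A.proj_core, h.proj_bracket_core]) (A.coreMap_core _)
  rw [Module.Dual.lie_apply, corePairing_apply, corePairing_apply, hcore, hlie,
    h.zeroSection_proj_bracket]
  exact eq_neg_of_add_eq_zero_left (h.courantAlgebroid.metric_invariant _ _ _).symm

theorem exists_isIso_semidirect (h : A.IsVBCourant)
    (hlie : ∀ x y : V, ⁅x, y⁆ = A.proj (A.courant.bracket (A.zeroSection x) (A.zeroSection y))) :
    ∃ θ : A.Core ≃ₗ[ℝ] Module.Dual ℝ V, A.courant.IsIso (semidirect V) (A.splitting θ) := by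
  have := h.corePairing_isPerfPair
  refine ⟨A.corePairing.toPerfPair, fun d e => (h.metric_eq d e).symm, fun d e => ?_⟩
  rw [h.bracket_eq, A.splitting_apply, A.splitting_apply, A.splitting_apply, semidirect_bracket]
  simp only [map_add, map_sub, h.proj_bracket_core, h.coreMap_bracket_zeroSection, ← hlie,
    sub_self, add_zero, zero_add, LinearMap.toLinearMap_toPerfPair,
    h.corePairing_bracket hlie]

end IsVBCourant

variable {θ : A.Core ≃ₗ[ℝ] Module.Dual ℝ V} {β : LinearMap.BilinForm ℝ (Module.Dual ℝ V)}

lemma graphFibreAdd_eq_preimage (θ : A.Core ≃ₗ[ℝ] Module.Dual ℝ V) : A.graphFibreAdd =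
    (A.splitting θ).prodCongr ((A.splitting θ).prodCongr (A.splitting θ)) ⁻¹'
      {z | z.2.1.1 = z.1.1 ∧ z.2.2.1 = z.1.1 ∧ z.1.2 = z.2.1.2 + z.2.2.2} := by
  ext z
  rw [DoubleVB.mem_graphFibreAdd, ← θ.injective.eq_iff, map_add]
  rfl

lemma isVBCourant_of_isIso_semidirect (h : A.courant.IsIso (semidirect V) (A.splitting θ)) :
    A.IsVBCourant where
  courantAlgebroid := h.isCourantAlgebroid semidirect_isCourantAlgebroid
  graph_add := by
    rw [graphFibreAdd_eq_preimage θ]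
    exact ((h.prod h).isCourantRelation_preimage_iff h).2 semidirect_isCourantRelation_fibreAdd

lemma IsActionAlgebroid.poissonRelation_eq_preimage
    (h : A.IsActionAlgebroid (sharp β ∘ₗ θ.toLinearMap)) : A.poissonRelation =
      ((A.splitting θ).prodCongr (A.splitting θ)).prodCongr
        ((A.splitting θ).prodCongr (A.splitting θ)) ⁻¹' sharpRelation β := by
  ext w
  rw [h.mem_poissonRelation_iff, ← θ.injective.eq_iff (a := A.coreMap w.1.2)]
  rfl

theorem isLACourant_iff_exists_isActionAlgebroid
    (h : A.courant.IsIso (semidirect V) (A.splitting θ)) :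
    A.IsLACourant ↔ ∃ β : LinearMap.BilinForm ℝ (Module.Dual ℝ V), β.IsSymm ∧
      β.lieInvariant V ∧ A.IsActionAlgebroid (sharp β ∘ₗ θ.toLinearMap) := by
  have courantRelation_iff {β : LinearMap.BilinForm ℝ (Module.Dual ℝ V)}
      (hβ : A.IsActionAlgebroid (sharp β ∘ₗ θ.toLinearMap)) :
      A.courant.tangent.IsCourantRelation A.courant.tangent A.poissonRelation ↔
        β.IsSymm ∧ β.lieInvariant V := by
    rw [hβ.poissonRelation_eq_preimage, h.tangent.isCourantRelation_preimage_iff h.tangent,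
      isCourantRelation_sharpRelation_iff]
  constructor
  · intro hA
    obtain ⟨a, ha⟩ := isLAVectorBundle_iff_exists_isActionAlgebroid.1 hA.laVectorBundle
    obtain ⟨β, hβ⟩ := exists_sharp_eq (a ∘ₗ θ.symm.toLinearMap)
    obtain rfl : sharp β ∘ₗ θ.toLinearMap = a := by
      rw [hβ]
      ext c
      simp
    obtain ⟨hsymm, hinv⟩ := (courantRelation_iff ha).1 hA.courantRelation
    exact ⟨β, hsymm, hinv, ha⟩
  · rintro ⟨β, hsymm, hinv, hβ⟩
    exact ⟨isVBCourant_of_isIso_semidirect h,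
      isLAVectorBundle_iff_exists_isActionAlgebroid.2 ⟨_, hβ⟩,
      (courantRelation_iff hβ).2 ⟨hsymm, hinv⟩⟩

lemma coe_subbundle_eq_preimage (θ : A.Core ≃ₗ[ℝ] Module.Dual ℝ V) (W : Submodule ℝ V)
    (K : Submodule ℝ (Module.Dual ℝ V)) :
    (A.subbundle W (K.comap θ.toLinearMap) : Set 𝔸) =
      A.splitting θ ⁻¹' ((W : Set V) ×ˢ (K : Set (Module.Dual ℝ V))) := rfl

lemma IsActionAlgebroid.isLADirac_subbundle_iff
    (hβ : A.IsActionAlgebroid (sharp β ∘ₗ θ.toLinearMap))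
    (h : A.courant.IsIso (semidirect V) (A.splitting θ)) {W : Submodule ℝ V}
    {K : Submodule ℝ (Module.Dual ℝ V)} :
    A.IsLADirac (A.splitting θ ⁻¹' ((W : Set V) ×ˢ (K : Set (Module.Dual ℝ V)))) ↔
      (K = W.dualAnnihilator ∧ ∀ x ∈ W, ∀ y ∈ W, ⁅x, y⁆ ∈ W) ∧ ∀ μ ∈ K, sharp β μ ∈ W := by
  have lieSubalgebroid_iff : A.IsLieSubalgebroid
      (A.splitting θ ⁻¹' ((W : Set V) ×ˢ (K : Set (Module.Dual ℝ V)))) ↔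
        ∀ μ ∈ K, sharp β μ ∈ W := by
    rw [← coe_subbundle_eq_preimage, hβ.isLieSubalgebroid_subbundle_iff,
      Submodule.map_le_iff_le_comap]
    exact ⟨fun H μ hμ => by simpa using H (x := θ.symm μ) (by simpa using hμ),
      fun H c hc => H _ hc⟩
  rw [← semidirect_isDirac_prod_iff, ← h.isDirac_preimage_iff, ← lieSubalgebroid_iff]
  exact ⟨fun H => ⟨H.dirac, H.lieSubalgebroid⟩,
    fun H => ⟨A.isSubbundle_subbundle W (K.comap θ.toLinearMap), H.1, H.2⟩⟩

theorem IsActionAlgebroid.isLADirac_iff (hβ : A.IsActionAlgebroid (sharp β ∘ₗ θ.toLinearMap))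
    (h : A.courant.IsIso (semidirect V) (A.splitting θ)) {L : Set 𝔸} :
    A.IsLADirac L ↔ ∃! 𝔥 : LieSubalgebra ℝ V, IsCoisotropicSubalgebra β 𝔥 ∧
      L = A.splitting θ ⁻¹'
        ((𝔥 : Set V) ×ˢ (𝔥.toSubmodule.dualAnnihilator : Set (Module.Dual ℝ V))) := by
  constructor
  · intro hL
    obtain ⟨W, K, rfl⟩ := hL.subbundle.exists_eq_subbundle
    obtain ⟨K, rfl⟩ := Submodule.comap_surjective_of_injective θ.injective K
    obtain ⟨⟨rfl, hlie⟩, hcoisotropic⟩ := (hβ.isLADirac_subbundle_iff h).1 hL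
    refine ⟨{ W with lie_mem' := fun hx hy => hlie _ hx _ hy }, ⟨hcoisotropic, rfl⟩, ?_⟩
    rintro 𝔥 ⟨-, heq⟩
    refine SetLike.ext fun x => ?_
    have hx := Set.ext_iff.1 heq (A.zeroSection x)
    simpa [A.splitting_zeroSection, DoubleVB.mem_subbundle] using hx.symm
  · rintro ⟨𝔥, ⟨hcoisotropic, rfl⟩, -⟩
    exact (hβ.isLADirac_subbundle_iff h).2
      ⟨⟨rfl, fun x hx y hy => 𝔥.lie_mem hx hy⟩, hcoisotropic⟩

end Semidirect

end Data

section Model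

variable {𝔤 : Type*} [LieRing 𝔤] [LieAlgebra ℝ 𝔤] [FiniteDimensional ℝ 𝔤]
  {β : LinearMap.BilinForm ℝ (Module.Dual ℝ 𝔤)}

/-- The identification of the core of `𝔤 ⋉ 𝔤*` with `𝔤*`. -/
def modelCore (β : LinearMap.BilinForm ℝ (Module.Dual ℝ 𝔤)) :
    (model 𝔤 β).Core ≃ₗ[ℝ] Module.Dual ℝ 𝔤 where
  toFun c := (c : 𝔤 × Module.Dual ℝ 𝔤).2
  map_add' _ _ := rfl
  map_smul' _ _ := rfl
  invFun μ := ⟨(0, μ), rfl⟩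
  left_inv c := Subtype.ext (Prod.ext ((model 𝔤 β).proj_core c).symm rfl)
  right_inv _ := rfl

lemma model_anchor (d : 𝔤 × Module.Dual ℝ 𝔤) : (model 𝔤 β).anchor d = sharp β d.2 := rfl

lemma modelCore_coreMap (d : 𝔤 × Module.Dual ℝ 𝔤) :
    modelCore β ((model 𝔤 β).coreMap d) = d.2 :=
  sub_zero d.2

lemma model_splitting (d : 𝔤 × Module.Dual ℝ 𝔤) :
    (model 𝔤 β).splitting (modelCore β) d = d :=
  Prod.ext rfl (modelCore_coreMap d)

lemma model_courant_isIso_semidirect :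
    (model 𝔤 β).courant.IsIso (semidirect 𝔤) ((model 𝔤 β).splitting (modelCore β)) where
  map_metric d e := by rw [model_splitting, model_splitting]; rfl
  map_bracket d e := by rw [model_splitting, model_splitting, model_splitting]; rfl

lemma model_isActionAlgebroid :
    (model 𝔤 β).IsActionAlgebroid (sharp β ∘ₗ (modelCore β).toLinearMap) where
  anchor_eq d := congrArg (sharp β) (modelCore_coreMap d).symm
  coreMap_bracket σ τ hσ hτ v := by
    rw [(model 𝔤 β).isSmoothSection_iff] at hσ hτ
    have hσ' := hσ.linear_comp (modelCore β).toLinearMap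
    have hτ' := hτ.linear_comp (modelCore β).toLinearMap
    refine (modelCore β).injective ((modelCore_coreMap _).trans ?_)
    have hmap := map_actionBracket (a := sharp β ∘ₗ (modelCore β).toLinearMap) (b := sharp β)
      (l := (modelCore β).toLinearMap) (m := LinearMap.id) (fun _ => rfl) hσ hτ hσ' hτ'
      (fun _ => rfl) (fun _ => rfl) v
    simp only [LinearEquiv.coe_coe, modelCore_coreMap] at hmap
    exact hmap.symm

theorem model_isLACourant (hsymm : β.IsSymm) (hinv : β.lieInvariant 𝔤) :
    (model 𝔤 β).IsLACourant :=
  (Data.isLACourant_iff_exists_isActionAlgebroid model_courant_isIso_semidirect).2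
    ⟨β, hsymm, hinv, model_isActionAlgebroid⟩

theorem Data.IsActionAlgebroid.isIso_model {𝔸 : Type*} [AddCommGroup 𝔸] [Module ℝ 𝔸]
    [FiniteDimensional ℝ 𝔸] {A : Data 𝔤 𝔸} {θ : A.Core ≃ₗ[ℝ] Module.Dual ℝ 𝔤}
    (hβ : A.IsActionAlgebroid (sharp β ∘ₗ θ.toLinearMap))
    (h : A.courant.IsIso (semidirect 𝔤) (A.splitting θ)) :
    A.IsIso (model 𝔤 β) (A.splitting θ) (LinearEquiv.refl ℝ 𝔤) :=
  (hβ.isIso_iff model_isActionAlgebroid).2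
    ⟨fun _ => rfl, A.splitting_zeroSection θ, h, fun d => (hβ.anchor_eq d).symm⟩

theorem model_isLADirac_iff {L : Set (𝔤 × Module.Dual ℝ 𝔤)} :
    (model 𝔤 β).IsLADirac L ↔ ∃! 𝔥 : LieSubalgebra ℝ 𝔤, IsCoisotropicSubalgebra β 𝔥 ∧
      L = (𝔥 : Set 𝔤) ×ˢ (𝔥.toSubmodule.dualAnnihilator : Set (Module.Dual ℝ 𝔤)) := by
  have hid : ((model 𝔤 β).splitting (modelCore β) : _ → 𝔤 × Module.Dual ℝ 𝔤) = id :=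
    funext model_splitting
  rw [model_isActionAlgebroid.isLADirac_iff model_courant_isIso_semidirect, hid]
  rfl

theorem model_isIso_iff {𝔤' : Type*} [LieRing 𝔤'] [LieAlgebra ℝ 𝔤'] [FiniteDimensional ℝ 𝔤']
    {β' : LinearMap.BilinForm ℝ (Module.Dual ℝ 𝔤')}
    {Φ : (𝔤 × Module.Dual ℝ 𝔤) ≃ₗ[ℝ] 𝔤' × Module.Dual ℝ 𝔤'} {φ : 𝔤 ≃ₗ[ℝ] 𝔤'} :
    (model 𝔤 β).IsIso (model 𝔤' β') Φ φ ↔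
      (∀ x y, φ ⁅x, y⁆ = ⁅φ x, φ y⁆) ∧
      (∀ μ ν : Module.Dual ℝ 𝔤', β' μ ν = β (μ ∘ₗ φ.toLinearMap) (ν ∘ₗ φ.toLinearMap)) ∧
      ∀ x μ, Φ (x, μ) = (φ x, μ ∘ₗ φ.symm.toLinearMap) := by
  have anchor_iff (hΦ : ∀ x μ, Φ (x, μ) = (φ x, μ ∘ₗ φ.symm.toLinearMap)) :
      (∀ d, (model 𝔤' β').anchor (Φ d) = φ ((model 𝔤 β).anchor d)) ↔
        ∀ μ ν : Module.Dual ℝ 𝔤', β' μ ν = β (μ ∘ₗ φ.toLinearMap) (ν ∘ₗ φ.toLinearMap) := by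
    rw [← sharp_eq_map_sharp_iff]
    refine ⟨fun h μ => ?_, fun h d => ?_⟩
    · simpa [hΦ, model_anchor, LinearMap.comp_assoc] using h (0, μ ∘ₗ φ.toLinearMap)
    · have hd := h (d.2 ∘ₗ φ.symm.toLinearMap)
      rw [LinearMap.comp_assoc, φ.symm_comp, LinearMap.comp_id] at hd
      rwa [hΦ d.1 d.2]
  rw [model_isActionAlgebroid.isIso_iff model_isActionAlgebroid]
  constructor
  · rintro ⟨hproj, hzero, hcourant, hanchor⟩
    obtain ⟨hφ, hΦ⟩ := semidirect_isIso_iff.1 ⟨hproj, hzero, hcourant⟩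
    exact ⟨hφ, (anchor_iff hΦ).1 hanchor, hΦ⟩
  · rintro ⟨hφ, hβ, hΦ⟩
    obtain ⟨hproj, hzero, hcourant⟩ := semidirect_isIso_iff.2 ⟨hφ, hΦ⟩
    exact ⟨hproj, hzero, hcourant, (anchor_iff hΦ).2 hβ⟩

end Model

end LACourant

end

theorem mainTheorem11 :
    -- each pair of a Lie algebra and an invariant symmetric form defines an LA-Courant algebroid
    (∀ (𝔤 : Type u) [LieRing 𝔤] [LieAlgebra ℝ 𝔤] [FiniteDimensional ℝ 𝔤]
      (β : LinearMap.BilinForm ℝ (Module.Dual ℝ 𝔤)), β.IsSymm → β.lieInvariant 𝔤 →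
      (LACourant.model 𝔤 β).IsLACourant) ∧
    -- every LA-Courant algebroid over a point is of this form
    (∀ (V : Type u) (𝔸 : Type v)
      [AddCommGroup V] [Module ℝ V] [FiniteDimensional ℝ V]
      [AddCommGroup 𝔸] [Module ℝ 𝔸] [FiniteDimensional ℝ 𝔸]
      (A : LACourant.Data V 𝔸), A.IsLACourant →
      ∃ (𝔤 : Type u) (_ : LieRing 𝔤) (_ : LieAlgebra ℝ 𝔤) (_ : FiniteDimensional ℝ 𝔤)
        (β : LinearMap.BilinForm ℝ (Module.Dual ℝ 𝔤)), β.IsSymm ∧ β.lieInvariant 𝔤 ∧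
        ∃ (Φ : 𝔸 ≃ₗ[ℝ] 𝔤 × Module.Dual ℝ 𝔤) (φ : V ≃ₗ[ℝ] 𝔤),
          A.IsIso (LACourant.model 𝔤 β) Φ φ) ∧
    -- the isomorphisms of the LA-Courant algebroids are those of the pairs
    (∀ (𝔤 : Type u) [LieRing 𝔤] [LieAlgebra ℝ 𝔤] [FiniteDimensional ℝ 𝔤]
      (𝔤' : Type v) [LieRing 𝔤'] [LieAlgebra ℝ 𝔤'] [FiniteDimensional ℝ 𝔤']
      (β : LinearMap.BilinForm ℝ (Module.Dual ℝ 𝔤))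
      (β' : LinearMap.BilinForm ℝ (Module.Dual ℝ 𝔤')),
      β.IsSymm → β.lieInvariant 𝔤 → β'.IsSymm → β'.lieInvariant 𝔤' →
      ∀ (Φ : (𝔤 × Module.Dual ℝ 𝔤) ≃ₗ[ℝ] 𝔤' × Module.Dual ℝ 𝔤') (φ : 𝔤 ≃ₗ[ℝ] 𝔤'),
        (LACourant.model 𝔤 β).IsIso (LACourant.model 𝔤' β') Φ φ ↔
          (∀ x y, φ ⁅x, y⁆ = ⁅φ x, φ y⁆) ∧
          (∀ μ ν : Module.Dual ℝ 𝔤', β' μ ν = β (μ ∘ₗ φ.toLinearMap) (ν ∘ₗ φ.toLinearMap)) ∧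
          ∀ x μ, Φ (x, μ) = (φ x, μ ∘ₗ φ.symm.toLinearMap)) ∧
    -- the LA-Dirac structures correspond to the coisotropic Lie subalgebras
    (∀ (𝔤 : Type u) [LieRing 𝔤] [LieAlgebra ℝ 𝔤] [FiniteDimensional ℝ 𝔤]
      (β : LinearMap.BilinForm ℝ (Module.Dual ℝ 𝔤)), β.IsSymm → β.lieInvariant 𝔤 →
      ∀ L : Set (𝔤 × Module.Dual ℝ 𝔤), (LACourant.model 𝔤 β).IsLADirac L ↔
        ∃! 𝔥 : LieSubalgebra ℝ 𝔤, LACourant.IsCoisotropicSubalgebra β 𝔥 ∧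
          L = (𝔥 : Set 𝔤) ×ˢ (𝔥.toSubmodule.dualAnnihilator : Set (Module.Dual ℝ 𝔤))) := by
  refine ⟨fun 𝔤 _ _ _ β hsymm hinv => LACourant.model_isLACourant hsymm hinv,
    fun V 𝔸 _ _ _ _ _ _ A hA => ?_,
    fun 𝔤 _ _ _ 𝔤' _ _ _ β β' _ _ _ _ Φ φ => LACourant.model_isIso_iff,
    fun 𝔤 _ _ _ β _ _ L => LACourant.model_isLADirac_iff⟩
  let _ : LieRing V := hA.vbCourant.lieRing
  let _ : LieAlgebra ℝ V := hA.vbCourant.lieAlgebra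
  obtain ⟨θ, hθ⟩ := hA.vbCourant.exists_isIso_semidirect fun _ _ => rfl
  obtain ⟨β, hsymm, hinv, hβ⟩ :=
    (LACourant.Data.isLACourant_iff_exists_isActionAlgebroid hθ).1 hA
  exact ⟨V, inferInstance, inferInstance, inferInstance, β, hsymm, hinv, A.splitting θ,
    LinearEquiv.refl ℝ V, hβ.isIso_model hθ⟩
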